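/- Let $\Omega$ be a profinite group and $N\le\Omega$ an open normal subgroup. For a group $G$ write $G^*$ for its continuous characters $G\to\mathbb{C}^\times$, and for an open subgroup $\Omega'\le\Omega$ containing $N$ write $\overline{\Omega}'=\Omega'/[N,N]$, where $[N,N]$ is the closed commutator subgroup. Let $R(\overline\Omega')$ be the Grothendieck group of finite-dimensional continuous complex representations of $\overline\Omega'$, and let $R_+(N\le\Omega')$ be the free abelian group on the $\Omega'$-conjugacy classes $[H,\chi]_{\Omega'}$ of pairs consisting of an open subgroup $H$ with $N\le H\le\Omega'$ and $\chi\in H^*$. The Brauer map is the homomorphism $$\varphi_{N\le\Omega'}:R_+(N\le\Omega')\to R(\overline\Omega'),\qquad [H,\chi]_{\Omega'}\mapsto \mathrm{Ind}_H^{\Omega'}(\chi).$$ $\Omega$ acts on $N^*$ by $\mu^g(x)=\mu(gxg^{-1})$. For an $\Omega'$-orbit $\xi\subseteq N^*$ let $R_+(N\le\Omega')_\xi$ be the subgroup generated by the $[H,\chi]_{\Omega'}$ with $\chi|_N\in\xi$, and let $R(\overline\Omega')_\xi$ be the subgroup generated by the irreducible representations $\rho$ such that the set of characters of $N$ occurring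 in $\rho|_N$ is $\xi$; for $\xi=\{\mu\}$ write $\mu$ instead of $\xi$. **Lemma.** Let $\mu\in N^*$, let $\xi\in N^*/\Omega$ be its orbit, and let $\Omega_\mu=\mathrm{Stab}_\Omega(\mu)\ge N$ be its stabilizer. Then $\varphi_{N\le\Omega}$ restricts to a map $\varphi_\xi:R_+(N\le\Omega)_\xi\to R(\overline\Omega)_\xi$, $\varphi_{N\le\Omega_\mu}$ restricts to a map $\varphi_\mu:R_+(N\le\Omega_\mu)_\mu\to R(\overline\Omega_\mu)_\mu$, and the diagram $$\begin{array}{ccccc} \mathrm{Ker}(\varphi_\mu)&\subset& R_+(N\le\Omega_\mu)_\mu&\xrightarrow{\ \varphi_\mu\ }&R(\overline\Omega_\mu)_\mu\\ \downarrow{\scriptstyle \mathrm{Ind}}&&\downarrow{\scriptstyle \mathrm{Ind}}&&\downarrow{\scriptstyle \mathrm{Ind}}\\ \mathrm{Ker}(\varphi_\xi)&\subset& R_+(N\le\Omega)_\xi&\xrightarrow{\ \varphi_\xi\ }&R(\overline\Omega)_\xi \end{array}$$ is commutative, where the first two vertical maps are given by $[H,\chi]_{\Omega_\mu}\mapsto[H,\chi]_\Omega$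 and the third one is induction of representations. All three vertical maps are bijections; in particular $$\mathrm{Ker}(\varphi_\xi)=\mathrm{Ind}_{\Omega_\mu}^{\Omega}(\mathrm{Ker}(\varphi_\mu)).$$ Moreover the $\Omega_\mu$-orbit of $\mu$ is $\{\mu\}$, and a character of $N$ is $\Omega_\mu$-invariant if and only if it is trivial on the closed commutator subgroup $[N,\Omega_\mu]$, i.e. $\mu\in(N^*)^{\Omega_\mu}=(N/[N,\Omega_\mu])^*$. -/

import Mathlib

open Topology

universe u v

/-! ## The Grothendieck group of continuous representations -/

/-- A finite-dimensional continuous complex representation of a topological group `G`.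
Continuity of `g ↦ ρ g` (for the usual topology of `End V`) is expressed by the continuity of
all matrix coefficients `g ↦ ℓ (ρ g v)`. -/
structure ContRep (G : Type u) [Group G] [TopologicalSpace G] : Type (u + 1) where
  V : Type u
  [addCommGroup : AddCommGroup V]
  [module : Module ℂ V]
  [finite : FiniteDimensional ℂ V]
  ρ : Representation ℂ G V
  continuous_coeff : ∀ (v : V) (l : Module.Dual ℂ V), Continuous fun g : G => l (ρ g v)

attribute [instance] ContRep.addCommGroup ContRep.module ContRep.finite

namespace ContRep

variable {G : Type u} [Group G] [TopologicalSpace G]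

/-- `0 → U → V → W → 0` is a short exact sequence of representations. -/
def IsShortExact (U V W : ContRep G) : Prop :=
  ∃ (i : U.ρ.IntertwiningMap V.ρ) (p : V.ρ.IntertwiningMap W.ρ),
    Function.Injective i ∧ Function.Exact i p ∧ Function.Surjective p

/-- The relations `[V] - [U] - [W]`, one for every short exact sequence `0 → U → V → W → 0`. -/
def relations (G : Type u) [Group G] [TopologicalSpace G] :
    AddSubgroup (FreeAbelianGroup (ContRep G)) :=
  AddSubgroup.closure {x | ∃ U V W : ContRep G, IsShortExact U V W ∧
    x = FreeAbelianGroup.of V - FreeAbelianGroup.of U - FreeAbelianGroup.of W}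

end ContRep

/-- `R(G)`: the Grothendieck group of (virtual) finite-dimensional continuous complex
representations of `G`. -/
abbrev RepGroup (G : Type u) [Group G] [TopologicalSpace G] : Type (u + 1) :=
  FreeAbelianGroup (ContRep G) ⧸ ContRep.relations G

namespace RepGroup

variable {G : Type u} [Group G] [TopologicalSpace G]

/-- The class `[V]` in `R(G)`. -/
def of (V : ContRep G) : RepGroup G :=
  QuotientAddGroup.mk (FreeAbelianGroup.of V)

theorem of_eq_add {U V W : ContRep G} (h : ContRep.IsShortExact U V W) :
    of V = of U + of W := by
  have h1 : (QuotientAddGroup.mk (FreeAbelianGroup.of V - FreeAbelianGroup.of U -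
      FreeAbelianGroup.of W) : RepGroup G) = 0 :=
    (QuotientAddGroup.eq_zero_iff _).2 (AddSubgroup.subset_closure ⟨U, V, W, h, rfl⟩)
  have h2 : of V - of U - of W = 0 := h1
  rw [sub_sub, sub_eq_zero] at h2
  exact h2

theorem of_eq_of_equiv {V W : ContRep G} (i : V.ρ.IntertwiningMap W.ρ)
    (hi : Function.Bijective i) : of V = of W := by
  let Z : ContRep G :=
    { V := PUnit.{u + 1}
      ρ := 1
      continuous_coeff := fun v l =>
        (continuous_const : Continuous fun _ : G => l v) }
  have hs : Subsingleton Z.V := inferInstanceAs (Subsingleton PUnit.{u + 1})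
  have hZ : of Z = of Z + of Z := by
    apply of_eq_add
    refine ⟨0, 0, fun a b _ => Subsingleton.elim a b,
      fun y => ⟨fun _ => ⟨y, Subsingleton.elim _ _⟩, fun _ => Subsingleton.elim _ _⟩,
      fun y => ⟨y, Subsingleton.elim _ _⟩⟩
  have hZ0 : of Z = 0 := by simpa using hZ
  have h : of W = of V + of Z := by
    apply of_eq_add
    refine ⟨i, 0, hi.1, fun y => ⟨fun _ => hi.2 y, fun _ => Subsingleton.elim _ _⟩,
      fun y => ⟨0, Subsingleton.elim _ _⟩⟩
  rw [h, hZ0, add_zero]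

end RepGroup

/-! ## Induction -/

section Induction

variable {A B : Type u} [Group A] [TopologicalSpace A] [Group B] [TopologicalSpace B]
  [IsTopologicalGroup B] [CompactSpace B]

theorem exists_finite_reps (f : A →* B) (hf : IsOpenMap f) :
    ∃ s : Finset B, ∀ b : B, ∃ a : A, ∃ r ∈ s, b = f a * r := by
  classical
  have ho : IsOpen (f.range : Set B) := by
    rw [MonoidHom.coe_range]; exact hf.isOpen_range
  have : Finite (B ⧸ f.range) := Subgroup.quotient_finite_of_isOpen _ ho
  have := Fintype.ofFinite (B ⧸ f.range)
  refine ⟨(Finset.univ : Finset (B ⧸ f.range)).image (fun q => (Quotient.out q)⁻¹),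
    fun b => ?_⟩
  have h : (QuotientGroup.mk (Quotient.out (QuotientGroup.mk b⁻¹ : B ⧸ f.range)) :
      B ⧸ f.range) = QuotientGroup.mk b⁻¹ := Quotient.out_eq _
  rw [QuotientGroup.eq] at h
  obtain ⟨a, ha⟩ := h
  refine ⟨a⁻¹, _, Finset.mem_image.2 ⟨QuotientGroup.mk b⁻¹, Finset.mem_univ _, rfl⟩, ?_⟩
  rw [map_inv, ha]
  group

variable {V : Type v} [AddCommGroup V] [Module ℂ V]

/-- Evaluation at a finite set of points. -/
def evalOn (f : A →* B) (ρ : Representation ℂ A V) (s : Finset B) :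
    Representation.coindV f ρ →ₗ[ℂ] (s → V) where
  toFun F r := F.1 r
  map_add' _ _ := rfl
  map_smul' _ _ := rfl

theorem evalOn_injective (f : A →* B) (ρ : Representation ℂ A V) {s : Finset B}
    (hs : ∀ b : B, ∃ a : A, ∃ r ∈ s, b = f a * r) : Function.Injective (evalOn f ρ s) := by
  intro F F' h
  apply Subtype.ext
  funext b
  obtain ⟨a, r, hr, rfl⟩ := hs b
  rw [F.2 a r, F'.2 a r]
  exact congrArg (ρ a) (congrFun h ⟨r, hr⟩)

variable [FiniteDimensional ℂ V]

theorem coind_finite (f : A →* B) (hf : IsOpenMap f) (ρ : Representation ℂ A V) :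
    FiniteDimensional ℂ (Representation.coindV f ρ) := by
  obtain ⟨s, hs⟩ := exists_finite_reps f hf
  exact FiniteDimensional.of_injective _ (evalOn_injective f ρ hs)

theorem coind_continuous_coeff (f : A →* B) (hf : IsOpenMap f) (ρ : Representation ℂ A V)
    (hρ : ∀ (v : V) (l : Module.Dual ℂ V), Continuous fun a : A => l (ρ a v))
    (F : Representation.coindV f ρ) (l : Module.Dual ℂ (Representation.coindV f ρ)) :
    Continuous fun b : B => l (Representation.coind f ρ b F) := by
  classical
  obtain ⟨s, hs⟩ := exists_finite_reps f hf
  have hinj := evalOn_injective f ρ hs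
  obtain ⟨m, hm⟩ := LinearMap.exists_leftInverse_of_injective _ (LinearMap.ker_eq_bot.2 hinj)
  have key : ∀ (m' : Module.Dual ℂ V) (y : B), Continuous fun x : B => m' (F.1 (x * y)) := by
    intro m' y
    have h1 : ∀ y : B, ContinuousAt (fun x : B => m' (F.1 (x * y))) 1 := by
      intro y U hU
      have h2 : (fun a : A => m' (ρ a (F.1 y))) ⁻¹' U ∈ 𝓝 (1 : A) := by
        apply (hρ (F.1 y) m').continuousAt
        simpa using hU
      have h3 := hf.image_mem_nhds h2
      rw [map_one] at h3
      refine Filter.mem_map.2 (Filter.mem_of_superset h3 ?_)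
      rintro _ ⟨a, ha, rfl⟩
      change m' (F.1 (f a * y)) ∈ U
      rw [F.2 a y]
      exact ha
    rw [continuous_iff_continuousAt]
    intro x₀
    have h4 := h1 (x₀ * y)
    have h5 : ContinuousAt (fun x : B => x * x₀⁻¹) x₀ := by fun_prop
    have h6 : Filter.Tendsto (fun x : B => x * x₀⁻¹) (𝓝 x₀) (𝓝 1) := by
      simpa [ContinuousAt] using h5
    have h7 := h4.tendsto.comp h6
    simpa [ContinuousAt, Function.comp_def, mul_assoc] using h7
  have h0 : ∀ b : B, l (Representation.coind f ρ b F) =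
      ∑ r : s, (l ∘ₗ m) (Pi.single r (F.1 (r * b))) := by
    intro b
    have h8 : Representation.coind f ρ b F =
        m (evalOn f ρ s (Representation.coind f ρ b F)) :=
      (LinearMap.congr_fun hm _).symm
    have h9 : evalOn f ρ s (Representation.coind f ρ b F) =
        ∑ r : s, Pi.single r (F.1 (r * b)) := by
      rw [Finset.univ_sum_single]
      rfl
    conv_lhs => rw [h8, h9]
    rw [← map_sum]
    rfl
  simp only [h0]
  refine continuous_finsetSum _ fun r _ => ?_
  have h10 := key ((l ∘ₗ m) ∘ₗ LinearMap.single ℂ (fun _ : s => V) r) 1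
  have h11 : Continuous fun b : B => (r : B) * b := by fun_prop
  simpa [Function.comp_def] using h10.comp h11

/-- The induced representation, realised on the space of functions `F : B → V` with
`F (f a * b) = ρ a (F b)` on which `B` acts by right translation, for an open homomorphism
`f : A → B` to a compact group. If `f` is the inclusion of an open subgroup `A`, then this is the
usual `Ind_A^B`; in general it is the induction from `f(A)` of the
subspace of `ker f`-invariants of `V`. -/
noncomputable def ContRep.ind (f : A →* B) (hf : IsOpenMap f) (V : ContRep A) : ContRep B where
  V := Representation.coindV f V.ρ
  finite := coind_finite f hf V.ρ
  ρ := Representation.coind f V.ρ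
  continuous_coeff := coind_continuous_coeff f hf V.ρ V.continuous_coeff

theorem ContRep.IsShortExact.ind {U V W : ContRep A} (h : ContRep.IsShortExact U V W)
    (f : A →* B) (hf : IsOpenEmbedding f) :
    ContRep.IsShortExact (U.ind f hf.isOpenMap) (V.ind f hf.isOpenMap)
      (W.ind f hf.isOpenMap) := by
  classical
  obtain ⟨i, p, hi, he, hp⟩ := h
  refine ⟨Representation.coindMap f i, Representation.coindMap f p, ?_, ?_, ?_⟩
  · intro F F' hF
    apply Subtype.ext
    funext b
    exact hi (congrFun (congrArg Subtype.val hF) b)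
  · intro F
    constructor
    · intro hF
      have hF' : ∀ b, ∃ x, i x = F.1 b := fun b =>
        (he _).1 (congrFun (congrArg Subtype.val hF) b)
      choose E hE using hF'
      refine ⟨⟨E, fun a b => hi ?_⟩, ?_⟩
      · rw [hE, F.2 a b, ← hE]
        exact (LinearMap.congr_fun (i.isIntertwining' a) (E b)).symm
      · apply Subtype.ext
        funext b
        exact hE b
    · rintro ⟨E, rfl⟩
      apply Subtype.ext
      funext b
      exact (he _).2 ⟨E.1 b, rfl⟩
  · intro F
    choose q hq using hp
    let S : Setoid B := QuotientGroup.rightRel f.range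
    have hr : ∀ b : B, ∃ a : A, b = f a * (Quotient.mk S b).out := by
      intro b
      have h : S.r ((Quotient.mk S b).out) b := Quotient.exact (Quotient.out_eq _)
      obtain ⟨a, ha⟩ := QuotientGroup.rightRel_apply.1 h
      exact ⟨a, by rw [ha]; group⟩
    choose t ht using hr
    have htr : ∀ (a : A) (b : B), Quotient.mk S (f a * b) = Quotient.mk S b := by
      intro a b
      apply Quotient.sound
      apply QuotientGroup.rightRel_apply.2
      exact ⟨a⁻¹, by rw [map_inv]; group⟩
    have htm : ∀ (a : A) (b : B), t (f a * b) = a * t b := by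
      intro a b
      apply hf.injective
      have h1 := ht (f a * b)
      rw [htr] at h1
      have h2 := ht b
      rw [map_mul]
      apply mul_right_cancel (b := (Quotient.mk S b).out)
      rw [← h1, mul_assoc, ← h2]
    refine ⟨⟨fun b => V.ρ (t b) (q (F.1 (Quotient.mk S b).out)), fun a b => ?_⟩, ?_⟩
    · simp only [htm, htr, map_mul, Module.End.mul_apply]
    · apply Subtype.ext
      funext b
      change p (V.ρ (t b) (q (F.1 (Quotient.mk S b).out))) = F.1 b
      have h1 := LinearMap.congr_fun (p.isIntertwining' (t b)) (q (F.1 (Quotient.mk S b).out))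
      refine h1.trans ?_
      change W.ρ (t b) (p (q (F.1 (Quotient.mk S b).out))) = F.1 b
      rw [hq]
      conv_rhs => rw [ht b]
      exact (F.2 _ _).symm

/-- Induction `R(A) → R(B)` along an open embedding `f : A → B`. -/
noncomputable def RepGroup.ind (f : A →* B) (hf : IsOpenEmbedding f) : RepGroup A →+ RepGroup B :=
  QuotientAddGroup.lift _
    (FreeAbelianGroup.lift fun V : ContRep A => RepGroup.of (V.ind f hf.isOpenMap)) (by
      rw [ContRep.relations, AddSubgroup.closure_le]
      rintro x ⟨U, V, W, h, rfl⟩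
      change FreeAbelianGroup.lift _ _ = 0
      rw [map_sub, map_sub, FreeAbelianGroup.lift_apply_of, FreeAbelianGroup.lift_apply_of,
        FreeAbelianGroup.lift_apply_of, RepGroup.of_eq_add (h.ind f hf)]
      abel)

end Induction

/-! ## Pairs `(Ω, N)` -/

section Pair

variable {Ω : Type u} [Group Ω] [TopologicalSpace Ω] [IsTopologicalGroup Ω]

/-- The closed commutator subgroup `[N, N]` of an open normal subgroup `N`. -/
def closedCommutator (N : OpenNormalSubgroup Ω) : Subgroup Ω :=
  (⁅N.toSubgroup, N.toSubgroup⁆).topologicalClosure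

instance (N : OpenNormalSubgroup Ω) : (closedCommutator N).Normal :=
  Subgroup.is_normal_topologicalClosure _

/-- The quotient `Ω / [N, N]`. -/
abbrev Bar (N : OpenNormalSubgroup Ω) : Type u := Ω ⧸ closedCommutator N

/-- `N^*`: the continuous characters `N → ℂˣ`. -/
abbrev CharGroup (N : OpenNormalSubgroup Ω) : Type u := N →ₜ* ℂˣ

/-- The conjugate character `μ^g (x) = μ (g x g⁻¹)`. -/
noncomputable def CharGroup.conj {N : OpenNormalSubgroup Ω} (μ : CharGroup N) (g : Ω) : CharGroup N where
  toFun x := μ ⟨g * x * g⁻¹, N.isNormal'.conj_mem x x.2 g⟩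
  map_one' := by
    rw [← map_one μ]
    congr 1
    apply Subtype.ext
    simp
  map_mul' x y := by
    rw [← map_mul μ]
    congr 1
    apply Subtype.ext
    simp
  continuous_toFun := by
    refine μ.continuous_toFun.comp (Continuous.subtype_mk ?_ _)
    fun_prop

instance (K : OpenSubgroup Ω) : IsTopologicalGroup K :=
  inferInstanceAs (IsTopologicalGroup K.toSubgroup)

instance [CompactSpace Ω] (K : OpenSubgroup Ω) : CompactSpace K :=
  isCompact_iff_compactSpace.1 K.isClosed.isCompact

/-- The orbit of `μ` under conjugation by `Ω`. -/
def CharGroup.orbit {N : OpenNormalSubgroup Ω} (μ : CharGroup N) : Set (CharGroup N) :=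
  Set.range fun g : Ω => μ.conj g

theorem CharGroup.conj_mul {N : OpenNormalSubgroup Ω} (μ : CharGroup N) (g h : Ω) :
    μ.conj (g * h) = (μ.conj g).conj h := by
  ext x
  change ((μ _ : ℂˣ) : ℂ) = ((μ _ : ℂˣ) : ℂ)
  congr 2
  apply Subtype.ext
  simp [mul_assoc]

theorem CharGroup.conj_of_mem {N : OpenNormalSubgroup Ω} (μ : CharGroup N) {g : Ω}
    (hg : g ∈ N) : μ.conj g = μ := by
  ext x
  change ((μ (⟨g, hg⟩ * x * ⟨g, hg⟩⁻¹) : ℂˣ) : ℂ) = ((μ x : ℂˣ) : ℂ)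
  rw [map_mul, map_mul, map_inv, mul_comm (μ ⟨g, hg⟩), mul_inv_cancel_right]

/-- The stabilizer `Ω_μ` of `μ` under conjugation, an open subgroup of `Ω` because it
contains `N`. -/
def CharGroup.stabilizer {N : OpenNormalSubgroup Ω} (μ : CharGroup N) : OpenSubgroup Ω where
  carrier := {g | μ.conj g = μ}
  one_mem' := μ.conj_of_mem N.one_mem'
  mul_mem' {a b} ha hb := by
    change μ.conj (a * b) = μ
    rw [CharGroup.conj_mul, show μ.conj a = μ from ha, show μ.conj b = μ from hb]
  inv_mem' {a} ha := by
    change μ.conj a⁻¹ = μ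
    conv_lhs => rw [← show μ.conj a = μ from ha]
    rw [← CharGroup.conj_mul, mul_inv_cancel]
    exact μ.conj_of_mem N.one_mem'
  isOpen' := by
    rw [isOpen_iff_mem_nhds]
    intro g hg
    have h1 : {x : Ω | g⁻¹ * x ∈ N} ∈ 𝓝 g := by
      refine IsOpen.mem_nhds (N.isOpen'.preimage (continuous_const_mul g⁻¹)) ?_
      change g⁻¹ * g ∈ N.toSubgroup
      rw [inv_mul_cancel]
      exact N.toSubgroup.one_mem
    refine Filter.mem_of_superset h1 fun x hx => ?_
    change μ.conj x = μ
    rw [← mul_inv_cancel_left g x, CharGroup.conj_mul, show μ.conj g = μ from hg]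
    exact μ.conj_of_mem hx

/-- `(H, χ)` with `H` an open subgroup of `Ω` containing `N` and `χ` a continuous
character of `H`: an element of `R_1(N ≤ Ω)`. -/
structure MonomialPair (N : OpenNormalSubgroup Ω) where
  H : OpenSubgroup Ω
  le : ∀ x ∈ N, x ∈ H
  χ : H →ₜ* ℂˣ

namespace MonomialPair

variable {N : OpenNormalSubgroup Ω}

/-- `q = p^g` for some `g ∈ Ω`, where `(H, χ)^g = (g⁻¹ H g, χ^g)` and
`χ^g (x) = χ (g x g⁻¹)`. -/
def IsConjugate (p q : MonomialPair N) : Prop :=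
  ∃ (g : Ω) (h : ∀ x, x ∈ q.H ↔ g * x * g⁻¹ ∈ p.H),
    ∀ (x : Ω) (hx : x ∈ q.H), q.χ ⟨x, hx⟩ = p.χ ⟨g * x * g⁻¹, (h x).1 hx⟩

/-- `Ω`-conjugacy of the pairs `(H, χ)`. -/
instance setoid (N : OpenNormalSubgroup Ω) : Setoid (MonomialPair N) where
  r := IsConjugate
  iseqv :=
    { refl := fun p => ⟨1, fun x => by simp, fun x hx => by simp⟩
      symm := by
        rintro p q ⟨g, h, hχ⟩
        refine ⟨g⁻¹, fun x => ?_, fun x hx => ?_⟩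
        · rw [h]
          simp [mul_assoc]
        · rw [hχ]
          congr 1
          apply Subtype.ext
          simp [mul_assoc]
      trans := by
        rintro p q r ⟨g, h, hχ⟩ ⟨g', h', hχ'⟩
        refine ⟨g * g', fun x => ?_, fun x hx => ?_⟩
        · rw [h', h]
          simp [mul_assoc]
        · rw [hχ', hχ]
          congr 1
          apply Subtype.ext
          simp [mul_assoc] }

/-- The restriction `χ|_N`. -/
noncomputable def resN (p : MonomialPair N) : CharGroup N where
  toFun x := p.χ ⟨x, p.le x x.2⟩
  map_one' := map_one p.χ
  map_mul' x y := map_mul p.χ ⟨x, p.le x x.2⟩ ⟨y, p.le y y.2⟩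
  continuous_toFun := p.χ.continuous_toFun.comp
    (Continuous.subtype_mk continuous_subtype_val _)

/-- The homomorphism `H → Ω / [N, N]`. -/
def toBar (p : MonomialPair N) : p.H →* Bar N :=
  (QuotientGroup.mk' (closedCommutator N)).comp (SubgroupClass.subtype p.H)

theorem isOpenMap_toBar (p : MonomialPair N) : IsOpenMap p.toBar :=
  QuotientGroup.isOpenMap_coe.comp p.H.isOpen.isOpenMap_subtype_val

/-- The one-dimensional representation of `H` on `ℂ` by `χ`. -/
noncomputable def charRep (p : MonomialPair N) : Representation ℂ p.H ℂ where
  toFun h := ((p.χ h : ℂˣ) : ℂ) • LinearMap.id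
  map_one' := by
    rw [map_one, Units.val_one, one_smul]
    rfl
  map_mul' a b := by
    apply LinearMap.ext
    intro z
    simp [mul_assoc, mul_left_comm]

theorem charRep_continuous_coeff (p : MonomialPair N) (v : ℂ) (l : Module.Dual ℂ ℂ) :
    Continuous fun h : p.H => l (p.charRep h v) := by
  have h : ∀ h : p.H, l (p.charRep h v) = ((p.χ h : ℂˣ) : ℂ) * l v := fun h =>
    map_smul l _ _
  simp only [h]
  exact (Units.continuous_val.comp p.χ.continuous_toFun).mul continuous_const

variable [CompactSpace Ω]

/-- `Ind_H^Ω(χ)` as a representation of `Ω / [N, N]`. The kernel `[N, N]` of `H → Ω / [N, N]`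
is contained in `N ≤ H` and `χ` is trivial on it, so that this is the representation of
`Ω / [N, N]` induced from the character of `H / [N, N]` given by `χ`. -/
noncomputable def indRep (p : MonomialPair N) : ContRep (Bar N) where
  V := Representation.coindV p.toBar p.charRep
  finite := coind_finite p.toBar p.isOpenMap_toBar p.charRep
  ρ := Representation.coind p.toBar p.charRep
  continuous_coeff := coind_continuous_coeff p.toBar p.isOpenMap_toBar p.charRep
    p.charRep_continuous_coeff

theorem of_indRep_eq {p q : MonomialPair N} (h : IsConjugate p q) :
    RepGroup.of p.indRep = RepGroup.of q.indRep := by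
  obtain ⟨g, hg, hχ⟩ := h
  have hmem : ∀ F : Representation.coindV p.toBar p.charRep,
      (fun b : Bar N => F.1 ((g : Bar N) * b)) ∈ Representation.coindV q.toBar q.charRep := by
    intro F y b
    have h1 : (g : Bar N) * (q.toBar y * b) =
        p.toBar ⟨g * y * g⁻¹, (hg y).1 y.2⟩ * ((g : Bar N) * b) := by
      change (g : Bar N) * (((y : Ω) : Bar N) * b) =
        ((g * (y : Ω) * g⁻¹ : Ω) : Bar N) * ((g : Bar N) * b)
      simp [mul_assoc]
    change F.1 ((g : Bar N) * (q.toBar y * b)) = _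
    rw [h1, F.2 _ _]
    have h2 : q.charRep y = p.charRep ⟨g * y * g⁻¹, (hg y).1 y.2⟩ :=
      congrArg (fun z : ℂˣ => (z : ℂ) • (LinearMap.id : ℂ →ₗ[ℂ] ℂ)) (hχ y y.2)
    rw [h2]
  have hmem' : ∀ F : Representation.coindV q.toBar q.charRep,
      (fun b : Bar N => F.1 ((g : Bar N)⁻¹ * b)) ∈
        Representation.coindV p.toBar p.charRep := by
    intro F y b
    have hy : g⁻¹ * (y : Ω) * g ∈ q.H := by
      rw [hg]
      simp [mul_assoc]
    have h1 : (g : Bar N)⁻¹ * (p.toBar y * b) =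
        q.toBar ⟨g⁻¹ * y * g, hy⟩ * ((g : Bar N)⁻¹ * b) := by
      change (g : Bar N)⁻¹ * (((y : Ω) : Bar N) * b) =
        ((g⁻¹ * (y : Ω) * g : Ω) : Bar N) * ((g : Bar N)⁻¹ * b)
      simp [mul_assoc]
    change F.1 ((g : Bar N)⁻¹ * (p.toBar y * b)) = _
    rw [h1, F.2 _ _]
    have h2 : q.charRep ⟨g⁻¹ * y * g, hy⟩ = p.charRep y := by
      refine congrArg (fun z : ℂˣ => (z : ℂ) • (LinearMap.id : ℂ →ₗ[ℂ] ℂ)) ?_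
      rw [hχ _ hy]
      congr 1
      apply Subtype.ext
      simp [mul_assoc]
    rw [h2]
  let i : p.indRep.ρ.IntertwiningMap q.indRep.ρ :=
    { toFun := fun F => ⟨fun b => F.1 ((g : Bar N) * b), hmem F⟩
      map_add' := fun _ _ => rfl
      map_smul' := fun _ _ => rfl
      isIntertwining' := fun b => by
        apply LinearMap.ext
        intro F
        apply Subtype.ext
        funext x
        exact congrArg F.1 (mul_assoc _ _ _) }
  refine RepGroup.of_eq_of_equiv i ⟨fun F F' h => ?_, fun F => ?_⟩
  · apply Subtype.ext
    funext b
    have := congrFun (congrArg Subtype.val h) ((g : Bar N)⁻¹ * b)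
    change F.1 ((g : Bar N) * ((g : Bar N)⁻¹ * b)) =
      F'.1 ((g : Bar N) * ((g : Bar N)⁻¹ * b)) at this
    rwa [mul_inv_cancel_left] at this
  · refine ⟨⟨fun b => F.1 ((g : Bar N)⁻¹ * b), hmem' F⟩, ?_⟩
    apply Subtype.ext
    funext b
    exact congrArg F.1 (inv_mul_cancel_left _ _)

end MonomialPair

/-- `R_+(N ≤ Ω)`: the free abelian group on the `Ω`-conjugacy classes `[H, χ]`, `H ≥ N`. -/
abbrev RPlus (N : OpenNormalSubgroup Ω) : Type u :=
  FreeAbelianGroup (Quotient (MonomialPair.setoid N))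

/-- The generator `[H, χ]` of `R_+(N ≤ Ω)`. -/
noncomputable def RPlus.of {N : OpenNormalSubgroup Ω} (p : MonomialPair N) : RPlus N :=
  FreeAbelianGroup.of (Quotient.mk _ p)

/-- The subgroup `R_+(N ≤ Ω)_ξ` generated by the `[H, χ]` with `χ|_N ∈ ξ`, for a
conjugation stable set `ξ` of characters of `N`. -/
def RPlus.part (N : OpenNormalSubgroup Ω) (ξ : Set (CharGroup N)) : AddSubgroup (RPlus N) :=
  AddSubgroup.closure {x | ∃ p : MonomialPair N, p.resN ∈ ξ ∧ x = RPlus.of p}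

/-- The set of characters of `N` that occur in a representation of `Ω / [N, N]`. -/
def ContRep.charsOn (N : OpenNormalSubgroup Ω) (V : ContRep (Bar N)) : Set (CharGroup N) :=
  {μ | ∃ v : V.V, v ≠ 0 ∧ ∀ n : N, V.ρ ((n : Ω) : Bar N) v = ((μ n : ℂˣ) : ℂ) • v}

/-- The subgroup `R(Ω / [N, N])_ξ` generated by the irreducible representations whose
restriction to `N` has exactly the characters in `ξ` as constituents. -/
def RepGroup.part (N : OpenNormalSubgroup Ω) (ξ : Set (CharGroup N)) :
    AddSubgroup (RepGroup (Bar N)) :=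
  AddSubgroup.closure {x | ∃ V : ContRep (Bar N),
    V.ρ.IsIrreducible ∧ V.charsOn N = ξ ∧ x = RepGroup.of V}

section Brauer

variable [CompactSpace Ω]

/-- The Brauer map `φ_{N ≤ Ω} : R_+(N ≤ Ω) → R(Ω / [N, N])`, `[H, χ] ↦ Ind_H^Ω(χ)`. -/
noncomputable def brauerMap (N : OpenNormalSubgroup Ω) : RPlus N →+ RepGroup (Bar N) :=
  FreeAbelianGroup.lift (Quotient.lift (fun p : MonomialPair N => RepGroup.of p.indRep)
    fun _ _ h => MonomialPair.of_indRep_eq h)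

/-- `Ker(φ_ξ)`, the kernel of the restriction of the Brauer map to `R_+(N ≤ Ω)_ξ`. -/
noncomputable def brauerKer (N : OpenNormalSubgroup Ω) (ξ : Set (CharGroup N)) : AddSubgroup (RPlus N) :=
  RPlus.part N ξ ⊓ (brauerMap N).ker

end Brauer

/-! ## Passing to an open subgroup `K ≥ N` -/

/-- `N ∩ K` as an open normal subgroup of the open subgroup `K`; this is `N` itself,
regarded as a subgroup of `K`, if `N ≤ K`. -/
def OpenNormalSubgroup.within (N : OpenNormalSubgroup Ω) (K : OpenSubgroup Ω) :
    OpenNormalSubgroup K where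
  toSubgroup := N.toSubgroup.comap (SubgroupClass.subtype K)
  isOpen' := N.isOpen'.preimage continuous_subtype_val
  isNormal' := N.isNormal'.comap _

/-- A character of `N` as a character of `N ∩ K`. -/
noncomputable def CharGroup.within {N : OpenNormalSubgroup Ω} (μ : CharGroup N) (K : OpenSubgroup Ω) :
    CharGroup (N.within K) where
  toFun x := μ ⟨((x : K) : Ω), x.2⟩
  map_one' := map_one μ
  map_mul' x y := map_mul μ ⟨((x : K) : Ω), x.2⟩ ⟨((y : K) : Ω), y.2⟩
  continuous_toFun := μ.continuous_toFun.comp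
    (Continuous.subtype_mk (continuous_subtype_val.comp continuous_subtype_val) _)

theorem CharGroup.le_stabilizer {N : OpenNormalSubgroup Ω} (μ : CharGroup N) :
    ∀ x ∈ N, x ∈ μ.stabilizer :=
  fun _ hx => μ.conj_of_mem hx

section Sub

variable {N : OpenNormalSubgroup Ω} {K : OpenSubgroup Ω}

theorem mem_of_mem_map {H : Subgroup K} {x : Ω} (hx : x ∈ H.map (SubgroupClass.subtype K)) :
    x ∈ K := by
  obtain ⟨y, _, rfl⟩ := hx
  exact y.2

theorem mem_of_mem_map' {H : Subgroup K} {x : Ω} (hx : x ∈ H.map (SubgroupClass.subtype K)) :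
    (⟨x, mem_of_mem_map hx⟩ : K) ∈ H := by
  obtain ⟨y, hy, rfl⟩ := hx
  exact hy

/-- A pair `(H, χ)` for `K` regarded as a pair for `Ω`. -/
noncomputable def MonomialPair.extend (hK : ∀ x ∈ N, x ∈ K) (p : MonomialPair (N.within K)) :
    MonomialPair N where
  H :=
    { toSubgroup := p.H.toSubgroup.map (SubgroupClass.subtype K)
      isOpen' := K.isOpen.isOpenMap_subtype_val _ p.H.isOpen' }
  le x hx := ⟨⟨x, hK x hx⟩, p.le ⟨x, hK x hx⟩ hx, rfl⟩
  χ :=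
    { toFun := fun x => p.χ ⟨⟨x.1, mem_of_mem_map x.2⟩, mem_of_mem_map' x.2⟩
      map_one' := map_one p.χ
      map_mul' := fun x y => map_mul p.χ ⟨⟨x.1, mem_of_mem_map x.2⟩, mem_of_mem_map' x.2⟩
        ⟨⟨y.1, mem_of_mem_map y.2⟩, mem_of_mem_map' y.2⟩
      continuous_toFun := p.χ.continuous_toFun.comp
        (Continuous.subtype_mk (Continuous.subtype_mk continuous_subtype_val _) _) }

/-- Induction `R_+(N ≤ K) → R_+(N ≤ Ω)`, `[H, χ]_K ↦ [H, χ]_Ω`. -/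
noncomputable def RPlus.ind (N : OpenNormalSubgroup Ω) (K : OpenSubgroup Ω) (hK : ∀ x ∈ N, x ∈ K) :
    RPlus (N.within K) →+ RPlus N :=
  FreeAbelianGroup.map (Quotient.map (MonomialPair.extend hK) (by
    rintro p q ⟨g, h, hχ⟩
    refine ⟨g, fun x => ⟨?_, ?_⟩, ?_⟩
    · intro hx
      obtain ⟨y, hy, rfl⟩ : x ∈ q.H.toSubgroup.map (SubgroupClass.subtype K) := hx
      exact ⟨g * y * g⁻¹, (h y).1 hy, rfl⟩
    · intro hx
      obtain ⟨y, hy, hyx⟩ :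
        (g : Ω) * x * (g : Ω)⁻¹ ∈ p.H.toSubgroup.map (SubgroupClass.subtype K) := hx
      have hx : x = ((g⁻¹ * y * g : K) : Ω) := by
        change (y : Ω) = g * x * g⁻¹ at hyx
        simp [hyx, mul_assoc]
      refine ⟨g⁻¹ * y * g, (h _).2 ?_, hx.symm⟩
      simpa [mul_assoc] using hy
    · intro x hx
      exact hχ ⟨x, mem_of_mem_map hx⟩ (mem_of_mem_map' hx)))

theorem map_closedCommutator_within (hK : ∀ x ∈ N, x ∈ K) :
    (closedCommutator (N.within K)) =
      (closedCommutator N).comap (SubgroupClass.subtype K) := by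
  have h1 : (⁅(N.within K).toSubgroup, (N.within K).toSubgroup⁆).map (SubgroupClass.subtype K) =
      ⁅N.toSubgroup, N.toSubgroup⁆ := by
    rw [Subgroup.map_commutator]
    have : (N.within K).toSubgroup.map (SubgroupClass.subtype K) = N.toSubgroup := by
      ext x
      constructor
      · rintro ⟨y, hy, rfl⟩
        exact hy
      · intro hx
        exact ⟨⟨x, hK x hx⟩, hx, rfl⟩
    rw [this]
  have h2 : ((⁅(N.within K).toSubgroup, (N.within K).toSubgroup⁆ : Subgroup K) : Set K) =
      Subtype.val ⁻¹' ((⁅N.toSubgroup, N.toSubgroup⁆ : Subgroup Ω) : Set Ω) := by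
    rw [← h1]
    exact (Set.preimage_image_eq _ Subtype.val_injective).symm
  apply SetLike.coe_injective
  change closure _ = Subtype.val ⁻¹' closure _
  rw [h2]
  exact (K.isOpen.isOpenMap_subtype_val.preimage_closure_eq_closure_preimage
    continuous_subtype_val _).symm

/-- The inclusion `K / [N, N] → Ω / [N, N]`. -/
noncomputable def barInclusion (N : OpenNormalSubgroup Ω) (K : OpenSubgroup Ω) (hK : ∀ x ∈ N, x ∈ K) :
    Bar (N.within K) →* Bar N :=
  QuotientGroup.map _ _ (SubgroupClass.subtype K) (map_closedCommutator_within hK).le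

theorem isOpenEmbedding_barInclusion (hK : ∀ x ∈ N, x ∈ K) :
    IsOpenEmbedding (barInclusion N K hK) := by
  refine IsOpenEmbedding.of_continuous_injective_isOpenMap ?_ ?_ ?_
  · refine continuous_quot_lift _ ?_
    exact QuotientGroup.continuous_mk.comp continuous_subtype_val
  · rw [← MonoidHom.ker_eq_bot_iff, eq_bot_iff]
    intro x
    induction x using QuotientGroup.induction_on with
    | H k =>
      intro hk
      have h1 : ((k : Ω) : Bar N) = 1 := hk
      rw [QuotientGroup.eq_one_iff] at h1
      rw [Subgroup.mem_bot, QuotientGroup.eq_one_iff, map_closedCommutator_within hK]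
      exact h1
  · intro U hU
    have h1 : barInclusion N K hK '' U =
        (fun k : K => ((k : Ω) : Bar N)) '' ((fun k : K => (k : Bar (N.within K))) ⁻¹' U) := by
      conv_lhs => rw [← Set.image_preimage_eq U
        (QuotientGroup.mk_surjective (s := closedCommutator (N.within K)))]
      rw [← Set.image_comp]
      rfl
    rw [h1]
    exact (QuotientGroup.isOpenMap_coe.comp K.isOpen.isOpenMap_subtype_val) _
      (hU.preimage QuotientGroup.continuous_mk)

/-- Induction `R(K / [N, N]) → R(Ω / [N, N])`. -/
noncomputable def barInd [CompactSpace Ω] (N : OpenNormalSubgroup Ω) (K : OpenSubgroup Ω)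
    (hK : ∀ x ∈ N, x ∈ K) : RepGroup (Bar (N.within K)) →+ RepGroup (Bar N) :=
  RepGroup.ind (barInclusion N K hK) (isOpenEmbedding_barInclusion hK)

end Sub

/-! ## The stabilizer of a character -/

variable {N : OpenNormalSubgroup Ω}

/-- `N` as an open normal subgroup of `Ω_μ`. -/
abbrev CharGroup.stabN (μ : CharGroup N) : OpenNormalSubgroup μ.stabilizer :=
  N.within μ.stabilizer

/-- `μ` as a character of the subgroup `N` of `Ω_μ`. -/
noncomputable abbrev CharGroup.stabChar (μ : CharGroup N) : CharGroup μ.stabN :=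
  μ.within μ.stabilizer

/-- `Ind : R_+(N ≤ Ω_μ) → R_+(N ≤ Ω)`. -/
noncomputable abbrev CharGroup.indPlus (μ : CharGroup N) : RPlus μ.stabN →+ RPlus N :=
  RPlus.ind N μ.stabilizer μ.le_stabilizer

/-- `Ind : R(Ω_μ / [N, N]) → R(Ω / [N, N])`. -/
noncomputable abbrev CharGroup.indRep [CompactSpace Ω] (μ : CharGroup N) :
    RepGroup (Bar μ.stabN) →+ RepGroup (Bar N) :=
  barInd N μ.stabilizer μ.le_stabilizer

end Pair

/-! ### Averaging over a compact group. -/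

section Average

open MeasureTheory

variable {G : Type*} [Group G] [TopologicalSpace G] [IsTopologicalGroup G] [CompactSpace G]
  {V : Type*} [AddCommGroup V] [Module ℂ V] [FiniteDimensional ℂ V]

/-! This is Clifford theory for the normal subgroup `N`. In a representation `V` of `Ω / [N, N]` the
elements of `N` act by commuting operators. The element `g` carries the eigenspace of `ν^g` to that
of `ν`, so the set of characters of `N` on `V` is stable under conjugation, and it is nonempty if
`V` is nonzero.

On the representation side the inverse of induction is `V ↦ V_μ`, the `μ`-eigenspace with its action
of `Ω_μ`. If `N` acts on `W` by `μ`, a `μ`-isotypic function in `Ind W` vanishes off `Ω_μ` and is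
determined by its value at `1`, so `(Ind W)_μ ≅ W` (`of_isotypicRep_stabInd`). If all characters on
`V` are conjugate to `μ`, then `V → Ind (V_μ)` is bijective because it is so on `μ`-parts, and a
nonzero kernel or cokernel would have a nonzero `μ`-part (`bijective_of_isotypic`,
`of_stabInd_isotypicRep`). Averaging over the compact group `N` gives a projection onto `V_μ`; hence
`V ↦ V_μ` is exact and descends to Grothendieck groups. Neither functor has to be shown to preserve
irreducibility: by `of_mem_part`, passing to sub and quotient, any representation with characters in
one orbit has its class in the corresponding part.

On the monomial side, `χ|_N = μ` forces `H ≤ Ω_μ`, and an element conjugating two such pairs fixes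
`μ`. Every pair over the orbit can be conjugated to one over `μ`, so the generators already
correspond bijectively (`bijOn_indPlus`). Commutativity of the square is transitivity of induction,
and the bijection of kernels follows from the square together with injectivity of the right vertical
map. -/

/-- The averaging operator of a continuous finite-dimensional representation of a compact
group. -/
theorem Representation.exists_average (σ : Representation ℂ G V)
    (hσ : ∀ (v : V) (l : Module.Dual ℂ V), Continuous fun g : G => l (σ g v)) :
    ∃ P : V →ₗ[ℂ] V, (∀ g v, σ g (P v) = P v) ∧
      (∀ (l : Module.Dual ℂ V) (v : V) (c : ℂ), (∀ g, l (σ g v) = c) → l (P v) = c) ∧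
      (∀ (l l' : Module.Dual ℂ V) (v v' : V), (∀ g, l (σ g v) = l' (σ g v')) →
        l (P v) = l' (P v')) := by
  let _ : MeasurableSpace G := borel G
  have : BorelSpace G := ⟨rfl⟩
  -- Normalising on the compact set `⊤` gives total mass `1`.
  let m : Measure G := Measure.haarMeasure ⊤
  have hm : m.real Set.univ = 1 := by
    have : m Set.univ = 1 := Measure.haarMeasure_self (K₀ := (⊤ : TopologicalSpace.PositiveCompacts G))
    simp [Measure.real, this]
  have : IsFiniteMeasure m := ⟨by
    have : m Set.univ = 1 := Measure.haarMeasure_self (K₀ := (⊤ : TopologicalSpace.PositiveCompacts G))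
    simp [this]⟩
  have hint : ∀ (l : Module.Dual ℂ V) (v : V), Integrable (fun g => l (σ g v)) m := fun l v =>
    (hσ v l).integrable_of_hasCompactSupport (HasCompactSupport.of_compactSpace _)
  -- Integrating coordinates avoids choosing a norm on `V`; `hP` below shows that the result does
  -- not depend on the basis.
  let b := Module.finBasis ℂ V
  let P : V →ₗ[ℂ] V :=
    { toFun := fun v => ∑ i, (∫ g, b.coord i (σ g v) ∂m) • b i
      map_add' := fun v w => by
        simp only [map_add, ← Finset.sum_add_distrib, ← add_smul]
        refine Finset.sum_congr rfl fun i _ => ?_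
        rw [integral_add (hint _ _) (hint _ _)]
      map_smul' := fun c v => by
        simp only [map_smul, Finset.smul_sum, smul_smul, RingHom.id_apply, smul_eq_mul]
        refine Finset.sum_congr rfl fun i _ => ?_
        rw [integral_const_mul] }
  have hP : ∀ (l : Module.Dual ℂ V) (v : V), l (P v) = ∫ g, l (σ g v) ∂m := by
    intro l v
    change l (∑ i, (∫ g, b.coord i (σ g v) ∂m) • b i) = _
    have h1 : ∀ g, l (σ g v) = ∑ i, b.coord i (σ g v) * l (b i) := by
      intro g
      conv_lhs => rw [← b.sum_repr (σ g v), map_sum]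
      simp only [map_smul, smul_eq_mul, Module.Basis.coord_apply]
    simp only [h1]
    rw [integral_finsetSum _ fun i _ => (hint _ _).mul_const _]
    simp [integral_mul_const]
  refine ⟨P, fun g v => ?_, fun l v c h => ?_, fun l l' v v' h => ?_⟩
  · rw [← sub_eq_zero, ← Module.forall_dual_apply_eq_zero_iff ℂ]
    intro l
    rw [map_sub, sub_eq_zero, hP]
    -- Moving `σ g` into the functional turns invariance of `P v` into left invariance of Haar
    -- measure.
    have h1 := hP (l ∘ₗ σ g) v
    simp only [LinearMap.comp_apply] at h1
    rw [h1, ← integral_mul_left_eq_self (fun x => l (σ x v)) g]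
    simp
  · rw [hP]
    simp [h, hm]
  · rw [hP, hP]
    simp [h]

end Average

namespace ContRep

/-! ### Subrepresentations, quotients and their classes. -/

section General

variable {G : Type u} [Group G] [TopologicalSpace G]

/-- A subrepresentation as a continuous representation. -/
def sub (V : ContRep G) (S : Subrepresentation V.ρ) : ContRep G where
  V := S.toSubmodule
  ρ := S.toRepresentation
  continuous_coeff v l := by
    obtain ⟨l', hl'⟩ := LinearMap.exists_extend l
    refine (V.continuous_coeff v l').congr fun g => ?_
    rw [← hl']
    rfl

/-- The quotient by a subrepresentation as a continuous representation. -/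
def quot (V : ContRep G) (S : Subrepresentation V.ρ) : ContRep G where
  V := V.V ⧸ S.toSubmodule
  ρ := V.ρ.quotient S.toSubmodule fun g _ hv => S.apply_mem_toSubmodule g hv
  continuous_coeff v l := by
    obtain ⟨v, rfl⟩ := Submodule.mkQ_surjective _ v
    exact V.continuous_coeff v (l ∘ₗ S.toSubmodule.mkQ)

/-- The inclusion of a subrepresentation. -/
def subι (V : ContRep G) (S : Subrepresentation V.ρ) :
    (V.sub S).ρ.IntertwiningMap V.ρ where
  toLinearMap := S.toSubmodule.subtype
  isIntertwining' _ := rfl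

/-- The projection to the quotient by a subrepresentation. -/
def quotπ (V : ContRep G) (S : Subrepresentation V.ρ) :
    V.ρ.IntertwiningMap (V.quot S).ρ where
  toLinearMap := S.toSubmodule.mkQ
  isIntertwining' _ := rfl

theorem subι_injective (V : ContRep G) (S : Subrepresentation V.ρ) :
    Function.Injective (V.subι S) :=
  Subtype.val_injective

theorem quotπ_surjective (V : ContRep G) (S : Subrepresentation V.ρ) :
    Function.Surjective (V.quotπ S) :=
  Submodule.mkQ_surjective _

theorem quotπ_eq_zero_iff (V : ContRep G) (S : Subrepresentation V.ρ) (v : V.V) :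
    V.quotπ S v = 0 ↔ v ∈ S.toSubmodule :=
  Submodule.Quotient.mk_eq_zero _

theorem isShortExact_sub_quot (V : ContRep G) (S : Subrepresentation V.ρ) :
    IsShortExact (V.sub S) V (V.quot S) := by
  refine ⟨V.subι S, V.quotπ S, V.subι_injective S, fun v => ?_, V.quotπ_surjective S⟩
  rw [quotπ_eq_zero_iff]
  exact ⟨fun hv => ⟨⟨v, hv⟩, rfl⟩, by rintro ⟨w, rfl⟩; exact w.2⟩

theorem of_eq_zero_of_subsingleton (V : ContRep G) [Subsingleton V.V] : RepGroup.of V = 0 := by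
  have h : RepGroup.of V = RepGroup.of V + RepGroup.of V := by
    apply RepGroup.of_eq_add
    exact ⟨0, 0, fun a b _ => Subsingleton.elim a b,
      fun y => ⟨fun _ => ⟨y, Subsingleton.elim _ _⟩, fun _ => Subsingleton.elim _ _⟩,
      fun y => ⟨y, Subsingleton.elim _ _⟩⟩
  simpa using h

end General

/-! ### Characters of `N` on representations of `Ω / [N, N]`. -/

section Isotypic

variable {Ω : Type u} [Group Ω] [TopologicalSpace Ω] [IsTopologicalGroup Ω]
  {N : OpenNormalSubgroup Ω}

/-- Passing to `Ω / [N, N]` makes the image of `N` abelian; this yields common eigenvectors and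
makes the averaged projections commute with `N`. -/
theorem bar_commute (m n : N) :
    ((m : Ω) : Bar N) * ((n : Ω) : Bar N) = ((n : Ω) : Bar N) * ((m : Ω) : Bar N) := by
  rw [← QuotientGroup.mk_mul, ← QuotientGroup.mk_mul, QuotientGroup.eq]
  apply Subgroup.le_topologicalClosure
  have h := Subgroup.commutator_mem_commutator (N.toSubgroup.inv_mem n.2)
    (N.toSubgroup.inv_mem m.2)
  simpa [commutatorElement_def, mul_assoc] using h

theorem continuous_bar_coe : Continuous fun n : N => ((n : Ω) : Bar N) :=
  QuotientGroup.continuous_mk.comp continuous_subtype_val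

/-- The subspace of a representation of `Ω / [N, N]` on which `N` acts by `ν`. -/
def isotypic (V : ContRep (Bar N)) (ν : CharGroup N) : Submodule ℂ V.V where
  carrier := {v | ∀ n : N, V.ρ ((n : Ω) : Bar N) v = ((ν n : ℂˣ) : ℂ) • v}
  add_mem' ha hb n := by rw [map_add, ha n, hb n, smul_add]
  zero_mem' n := by rw [map_zero, smul_zero]
  smul_mem' c v hv n := by rw [map_smul, hv n, smul_comm]

theorem mem_charsOn_iff {V : ContRep (Bar N)} {ν : CharGroup N} :
    ν ∈ V.charsOn N ↔ ∃ v ∈ V.isotypic ν, v ≠ 0 :=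
  ⟨fun ⟨v, h0, h⟩ => ⟨v, h, h0⟩, fun ⟨v, h, h0⟩ => ⟨v, h0, h⟩⟩

theorem map_mem_isotypic {V W : ContRep (Bar N)} (T : V.ρ.IntertwiningMap W.ρ)
    {ν : CharGroup N} {v : V.V} (hv : v ∈ V.isotypic ν) : T v ∈ W.isotypic ν := fun n => by
  rw [← T.isIntertwining, hv n, map_smul]

theorem mem_isotypic_of_map_mem {V W : ContRep (Bar N)} (T : V.ρ.IntertwiningMap W.ρ)
    (hT : Function.Injective T) {ν : CharGroup N} {v : V.V} (hv : T v ∈ W.isotypic ν) :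
    v ∈ V.isotypic ν := fun n => by
  apply hT
  rw [T.isIntertwining, hv n, map_smul]

theorem bar_conj (V : ContRep (Bar N)) (g : Ω) (n : N) (v : V.V) :
    V.ρ ((n : Ω) : Bar N) (V.ρ (g : Bar N) v) =
      V.ρ (g : Bar N) (V.ρ ((g⁻¹ * n * g : Ω) : Bar N) v) := by
  rw [← Module.End.mul_apply, ← Module.End.mul_apply, ← map_mul, ← map_mul]
  congr 2
  rw [← QuotientGroup.mk_mul, ← QuotientGroup.mk_mul]
  congr 1
  group

/-- Since `n g = g (g⁻¹ n g)`, the group permutes the isotypic parts; in particular `V_μ` is stable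
under `Ω_μ`. -/
theorem apply_mem_isotypic {V : ContRep (Bar N)} {ν : CharGroup N} (g : Ω) {v : V.V}
    (hv : v ∈ V.isotypic (ν.conj g)) : V.ρ (g : Bar N) v ∈ V.isotypic ν := fun n => by
  have hn : g⁻¹ * (n : Ω) * g ∈ N := by
    have h := N.isNormal'.conj_mem n n.2 g⁻¹
    rwa [inv_inv] at h
  rw [bar_conj, hv ⟨_, hn⟩, map_smul]
  congr 2
  change ν _ = ν _
  congr 1
  apply Subtype.ext
  simp [mul_assoc]

theorem conj_mem_charsOn {V : ContRep (Bar N)} {ν : CharGroup N} (h : ν ∈ V.charsOn N)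
    (g : Ω) : ν.conj g ∈ V.charsOn N := by
  obtain ⟨v, hv, h0⟩ := mem_charsOn_iff.1 h
  refine mem_charsOn_iff.2 ⟨V.ρ ((g⁻¹ : Ω) : Bar N) v, apply_mem_isotypic g⁻¹ ?_, fun h => h0 ?_⟩
  · rw [← CharGroup.conj_mul, mul_inv_cancel, ν.conj_of_mem N.one_mem']
    exact hv
  · have h1 := congrArg (V.ρ (g : Bar N)) h
    rwa [map_zero, ← Module.End.mul_apply, ← map_mul, ← QuotientGroup.mk_mul, mul_inv_cancel,
      QuotientGroup.mk_one, map_one] at h1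

/-- In a minimal nonzero `N`-stable subspace every `n` acts as a scalar, because its eigenspaces
there are `N`-stable by commutativity. These scalars form a continuous character. -/
theorem charsOn_nonempty (V : ContRep (Bar N)) [Nontrivial V.V] : (V.charsOn N).Nonempty := by
  obtain ⟨W, ⟨hW0, hW⟩, hmin⟩ := exists_minimal_of_wellFoundedLT
    (fun W : Submodule ℂ V.V => W ≠ ⊥ ∧ ∀ (n : N), ∀ w ∈ W, V.ρ ((n : Ω) : Bar N) w ∈ W)
    ⟨⊤, top_ne_bot, fun _ _ _ => trivial⟩
  have hscalar : ∀ n : N, ∃ c : ℂ, ∀ w ∈ W, V.ρ ((n : Ω) : Bar N) w = c • w := by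
    intro n
    have : Nontrivial W := Submodule.nontrivial_iff_ne_bot.2 hW0
    obtain ⟨c, hc⟩ := Module.End.exists_eigenvalue ((V.ρ ((n : Ω) : Bar N)).restrict (hW n))
    obtain ⟨w, hw, hw0⟩ := hc.exists_hasEigenvector
    rw [Module.End.mem_eigenspace_iff] at hw
    have hw' : V.ρ ((n : Ω) : Bar N) w = c • (w : V.V) := congrArg Subtype.val hw
    refine ⟨c, fun x hx => ?_⟩
    have h2 := hmin (y := W ⊓ Module.End.eigenspace (V.ρ ((n : Ω) : Bar N)) c) ⟨?_, ?_⟩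
      inf_le_left hx
    · exact Module.End.mem_eigenspace_iff.1 h2.2
    · intro h
      apply hw0
      have h3 : (w : V.V) ∈ W ⊓ Module.End.eigenspace (V.ρ ((n : Ω) : Bar N)) c :=
        ⟨w.2, Module.End.mem_eigenspace_iff.2 hw'⟩
      rw [h, Submodule.mem_bot] at h3
      exact Subtype.ext h3
    · rintro m y ⟨hy, hy'⟩
      refine ⟨hW m y hy, Module.End.mem_eigenspace_iff.2 ?_⟩
      rw [← Module.End.mul_apply, ← map_mul, bar_commute, map_mul, Module.End.mul_apply,
        Module.End.mem_eigenspace_iff.1 hy', map_smul]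
  choose c hc using hscalar
  obtain ⟨w, hw, hw0⟩ := Submodule.exists_mem_ne_zero_of_ne_bot hW0
  have hone : c 1 = 1 := by
    apply smul_left_injective ℂ hw0
    change c 1 • w = (1 : ℂ) • w
    rw [← hc 1 w hw, one_smul]
    simp
  have hmul : ∀ m n, c (m * n) = c m * c n := by
    intro m n
    apply smul_left_injective ℂ hw0
    change c (m * n) • w = (c m * c n) • w
    rw [← hc _ w hw, mul_smul, ← hc n w hw, ← hc m _ (hW n w hw)]
    change V.ρ ((((m : Ω) * (n : Ω) : Ω)) : Bar N) w = _
    rw [QuotientGroup.mk_mul, map_mul, Module.End.mul_apply]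
  have hne : ∀ n, c n ≠ 0 := fun n h => by
    have h1 := hmul n n⁻¹
    rw [mul_inv_cancel, hone, h, zero_mul] at h1
    exact one_ne_zero h1
  -- With `l w = 1`, the scalar `c n` is the matrix coefficient `l (ρ n w)`, hence continuous.
  obtain ⟨l, hl⟩ := Module.Projective.exists_dual_eq_one ℂ hw0
  have hcont : Continuous c := by
    refine ((V.continuous_coeff w l).comp continuous_bar_coe).congr fun n => ?_
    change l (V.ρ ((n : Ω) : Bar N) w) = c n
    rw [hc n w hw, map_smul, hl, smul_eq_mul, mul_one]
  let ν : CharGroup N :=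
    { toFun := fun n => Units.mk0 (c n) (hne n)
      map_one' := Units.ext hone
      map_mul' := fun m n => Units.ext (hmul m n)
      continuous_toFun := Units.continuous_iff.2
        ⟨hcont, (hcont.inv₀ hne).congr fun n => by simp⟩ }
  exact ⟨ν, w, hw0, fun n => hc n w hw⟩

theorem charsOn_subset_of_injective {V W : ContRep (Bar N)} (T : V.ρ.IntertwiningMap W.ρ)
    (hT : Function.Injective T) : V.charsOn N ⊆ W.charsOn N := fun ν hν => by
  obtain ⟨v, hv, h0⟩ := mem_charsOn_iff.1 hν
  exact mem_charsOn_iff.2 ⟨T v, map_mem_isotypic T hv, fun h => h0 (hT (h.trans (map_zero T).symm))⟩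

/-- The characters on a nonzero representation form a nonempty conjugation-stable set, and an orbit
has no smaller one. -/
theorem charsOn_eq_orbit {V : ContRep (Bar N)} [Nontrivial V.V] {μ : CharGroup N}
    (h : V.charsOn N ⊆ μ.orbit) : V.charsOn N = μ.orbit := by
  refine h.antisymm ?_
  obtain ⟨ν, hν⟩ := V.charsOn_nonempty
  obtain ⟨g, rfl⟩ := h hν
  rintro _ ⟨g', rfl⟩
  have h1 := conj_mem_charsOn hν (g⁻¹ * g')
  rwa [← CharGroup.conj_mul, mul_inv_cancel_left] at h1

variable [CompactSpace Ω]

/-- Twisting by `ν⁻¹` turns `V_ν` into invariants, so averaging the twist over the compact group `N`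
projects onto it. The last property computes `T (P v)` for any linear `T`: it gives `P = id` on
`V_ν`, isotypic lifts along surjections, and commutation of `P` with the stabilizer. -/
theorem exists_isotypic_projection (V : ContRep (Bar N)) (ν : CharGroup N) :
    ∃ P : V.V →ₗ[ℂ] V.V, (∀ v, P v ∈ V.isotypic ν) ∧
      (∀ (n : N) (v : V.V), P (V.ρ ((n : Ω) : Bar N) v) = ((ν n : ℂˣ) : ℂ) • P v) ∧
      ∀ {W : Type u} [AddCommGroup W] [Module ℂ W] (T : V.V →ₗ[ℂ] W) (v : V.V) (w : W),
        (∀ n : N, T (V.ρ ((n : Ω) : Bar N) v) = ((ν n : ℂˣ) : ℂ) • w) → T (P v) = w := by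
  have : IsTopologicalGroup N := inferInstanceAs (IsTopologicalGroup N.toSubgroup)
  have : CompactSpace N := isCompact_iff_compactSpace.1 N.toOpenSubgroup.isClosed.isCompact
  let σ : Representation ℂ N V.V :=
    { toFun := fun n => (((ν n)⁻¹ : ℂˣ) : ℂ) • V.ρ ((n : Ω) : Bar N)
      map_one' := by
        rw [map_one, inv_one, Units.val_one, one_smul]
        exact map_one V.ρ
      map_mul' := fun m n => by
        have h : V.ρ (((m * n : N) : Ω) : Bar N) =
            V.ρ ((m : Ω) : Bar N) * V.ρ ((n : Ω) : Bar N) :=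
          map_mul V.ρ ((m : Ω) : Bar N) ((n : Ω) : Bar N)
        rw [h, map_mul, mul_inv, Units.val_mul, smul_mul_smul_comm] }
  have hσ : ∀ n v, σ n v = (((ν n)⁻¹ : ℂˣ) : ℂ) • V.ρ ((n : Ω) : Bar N) v := fun _ _ => rfl
  have hρ : ∀ (n : N) v, V.ρ ((n : Ω) : Bar N) v = ((ν n : ℂˣ) : ℂ) • σ n v := fun n v => by
    rw [hσ, smul_smul, Units.mul_inv, one_smul]
  obtain ⟨P, hP, hP1, hP2⟩ := σ.exists_average fun v l => by
    simp only [hσ, map_smul]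
    exact (Units.continuous_val.comp (continuous_inv.comp ν.continuous_toFun)).smul
      ((V.continuous_coeff v l).comp continuous_bar_coe)
  refine ⟨P, fun v n => ?_, fun n v => ?_, fun T v w h => ?_⟩
  · rw [hρ, hP]
  · rw [← sub_eq_zero, ← Module.forall_dual_apply_eq_zero_iff ℂ]
    intro l
    have h1 := hP2 l (l ∘ₗ V.ρ ((n : Ω) : Bar N)) (V.ρ ((n : Ω) : Bar N) v) v fun m => by
      rw [LinearMap.comp_apply, hσ, hσ, map_smul (V.ρ _), ← Module.End.mul_apply, ← map_mul,
        bar_commute, map_mul, Module.End.mul_apply]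
    rw [map_sub, sub_eq_zero, h1, LinearMap.comp_apply, hρ, hP]
  · rw [← sub_eq_zero, ← Module.forall_dual_apply_eq_zero_iff ℂ]
    intro l
    rw [map_sub, sub_eq_zero]
    refine hP1 (l ∘ₗ T) v (l w) fun n => ?_
    rw [LinearMap.comp_apply, hσ, map_smul, h n, smul_smul, Units.inv_mul, one_smul]

/-- Projecting an arbitrary preimage does not change its image; this is the right exactness of `V ↦
V_ν`. -/
theorem exists_isotypic_lift {V W : ContRep (Bar N)} (T : V.ρ.IntertwiningMap W.ρ)
    (hT : Function.Surjective T) {ν : CharGroup N} {w : W.V} (hw : w ∈ W.isotypic ν) :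
    ∃ v ∈ V.isotypic ν, T v = w := by
  obtain ⟨P, hP, -, hP2⟩ := V.exists_isotypic_projection ν
  obtain ⟨v, rfl⟩ := hT w
  refine ⟨P v, hP v, hP2 T.toLinearMap v (T v) fun n => ?_⟩
  rw [← hw n]
  exact T.isIntertwining _ _ _ v

theorem charsOn_subset_of_surjective {V W : ContRep (Bar N)} (T : V.ρ.IntertwiningMap W.ρ)
    (hT : Function.Surjective T) : W.charsOn N ⊆ V.charsOn N := fun ν hν => by
  obtain ⟨w, hw, h0⟩ := mem_charsOn_iff.1 hν
  obtain ⟨v, hv, rfl⟩ := exists_isotypic_lift T hT hw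
  exact mem_charsOn_iff.2 ⟨v, hv, fun h => h0 (by rw [h, map_zero])⟩

/-- A representation whose characters on `N` all lie in one orbit `ξ` has its class in
`R(Ω / [N, N])_ξ`. -/
theorem of_mem_part {μ : CharGroup N} (V : ContRep (Bar N)) (h : V.charsOn N ⊆ μ.orbit) :
    RepGroup.of V ∈ RepGroup.part N μ.orbit := by
  induction hn : Module.finrank ℂ V.V using Nat.strong_induction_on generalizing V with
  | _ n ih =>
  rcases subsingleton_or_nontrivial V.V with hs | hs
  · rw [of_eq_zero_of_subsingleton]
    exact zero_mem _
  by_cases hirr : ∀ S : Subrepresentation V.ρ, S = ⊥ ∨ S = ⊤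
  -- An irreducible `V` is itself a generator. Otherwise split off a proper nonzero
  -- subrepresentation: both pieces have smaller dimension and no new characters.
  · refine AddSubgroup.subset_closure ⟨V, ?_, charsOn_eq_orbit h, rfl⟩
    have : Nontrivial (Subrepresentation V.ρ) := ⟨⟨⊥, ⊤, fun h => bot_ne_top
      (congrArg Subrepresentation.toSubmodule h : (⊥ : Submodule ℂ V.V) = ⊤)⟩⟩
    exact ⟨hirr⟩
  · push Not at hirr
    obtain ⟨S, hS0, hS1⟩ := hirr
    rw [RepGroup.of_eq_add (V.isShortExact_sub_quot S)]
    have h0 : S.toSubmodule ≠ ⊥ := fun h =>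
      hS0 (Subrepresentation.toSubmodule_injective h)
    have h1 : S.toSubmodule ≠ ⊤ := fun h =>
      hS1 (Subrepresentation.toSubmodule_injective h)
    have h2 := Submodule.finrank_lt h1
    have h3 := Submodule.finrank_quotient_add_finrank S.toSubmodule
    have h4 : 0 < Module.finrank ℂ S.toSubmodule := by
      rw [Nat.pos_iff_ne_zero]
      exact fun h => h0 (Submodule.finrank_eq_zero.1 h)
    refine add_mem (ih _ ?_ (V.sub S)
        ((charsOn_subset_of_injective _ (V.subι_injective S)).trans h) rfl)
      (ih _ ?_ (V.quot S)
        ((charsOn_subset_of_surjective _ (V.quotπ_surjective S)).trans h) rfl)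
    · change Module.finrank ℂ S.toSubmodule < n
      omega
    · change Module.finrank ℂ (V.V ⧸ S.toSubmodule) < n
      omega

/-- An intertwining map between representations all of whose characters on `N` are conjugate
to `μ` is bijective if it is bijective on the `μ`-isotypic parts. -/
theorem bijective_of_isotypic {μ : CharGroup N} {V W : ContRep (Bar N)}
    (T : V.ρ.IntertwiningMap W.ρ) (hV : V.charsOn N ⊆ μ.orbit) (hW : W.charsOn N ⊆ μ.orbit)
    (hinj : ∀ v ∈ V.isotypic μ, T v = 0 → v = 0)
    (hsurj : ∀ w ∈ W.isotypic μ, ∃ v, T v = w) : Function.Bijective T := by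
  have hμ : μ ∈ μ.orbit := ⟨1, μ.conj_of_mem N.one_mem'⟩
  constructor
  · rw [injective_iff_map_eq_zero]
    intro v hv
    by_contra h0
    have hnt : Nontrivial (V.sub T.ker).V :=
      ⟨⟨⟨v, hv⟩, 0, fun h => h0 (congrArg Subtype.val h)⟩⟩
    -- A nonzero kernel carries the whole orbit, so it contains a nonzero `μ`-isotypic vector,
    -- against `hinj`. The cokernel is treated in the same way, lifting such a vector to `W`.
    have h1 := charsOn_eq_orbit
      ((charsOn_subset_of_injective _ (V.subι_injective T.ker)).trans hV)
    rw [← h1] at hμ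
    obtain ⟨x, hx, hx0⟩ := mem_charsOn_iff.1 hμ
    exact hx0 (Subtype.ext (hinj _ (map_mem_isotypic (V.subι T.ker) hx) x.2))
  · by_contra h
    have hnt : Nontrivial (W.quot T.range).V :=
      Submodule.Quotient.nontrivial_iff.2 fun h1 => h (LinearMap.range_eq_top.1 h1)
    have h1 := charsOn_eq_orbit
      ((charsOn_subset_of_surjective _ (W.quotπ_surjective T.range)).trans hW)
    rw [← h1] at hμ
    obtain ⟨x, hx, hx0⟩ := mem_charsOn_iff.1 hμ
    obtain ⟨w, hw, rfl⟩ := exists_isotypic_lift _ (W.quotπ_surjective T.range) hx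
    exact hx0 ((W.quotπ_eq_zero_iff _ _).2 (hsurj w hw))

end Isotypic

end ContRep

/-! ### The Clifford correspondence between `Ω_μ` and `Ω`. -/

section Stabilizer

variable {Ω : Type u} [Group Ω] [TopologicalSpace Ω] [IsTopologicalGroup Ω]
  {N : OpenNormalSubgroup Ω}

theorem CharGroup.self_mem_orbit (μ : CharGroup N) : μ ∈ μ.orbit :=
  ⟨1, μ.conj_of_mem N.one_mem'⟩

theorem CharGroup.orbit_stabChar (μ : CharGroup N) : μ.stabChar.orbit = {μ.stabChar} := by
  refine Set.Subset.antisymm ?_ (Set.singleton_subset_iff.2 μ.stabChar.self_mem_orbit)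
  rintro _ ⟨g, rfl⟩
  rw [Set.mem_singleton_iff]
  ext n
  have h : μ.conj g = μ := g.2
  exact congrArg (fun ν : CharGroup N => ((ν ⟨((n : μ.stabilizer) : Ω), n.2⟩ : ℂˣ) : ℂ)) h

/-- Write `g n = (g n g⁻¹) g`. The hypothesis only asks that `N` lift to elements of `A` acting by
`μ`, so that it covers both induction of a character from `H` and induction from `Ω_μ / [N, N]`. -/
theorem coind_apply_mul {A : Type*} [Monoid A] {f : A →* Bar N} {W : Type*} [AddCommGroup W]
    [Module ℂ W] {σ : Representation ℂ A W} {μ : CharGroup N}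
    (hσ : ∀ n : N, ∃ a, f a = ((n : Ω) : Bar N) ∧ ∀ w, σ a w = ((μ n : ℂˣ) : ℂ) • w)
    (F : Representation.coindV f σ) (g : Ω) (n : N) :
    F.1 ((g : Bar N) * ((n : Ω) : Bar N)) = ((μ.conj g n : ℂˣ) : ℂ) • F.1 (g : Bar N) := by
  obtain ⟨a, ha, hw⟩ := hσ ⟨g * n * g⁻¹, N.isNormal'.conj_mem n n.2 g⟩
  have h : (g : Bar N) * ((n : Ω) : Bar N) = f a * (g : Bar N) := by
    rw [ha, ← QuotientGroup.mk_mul, ← QuotientGroup.mk_mul]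
    simp
  rw [h, F.2 a, hw]
  rfl

/-- The value `F (g n)` is both `ν n • F g` and `μ^g n • F g`. So a `ν`-isotypic function is
supported where `μ^g = ν`. -/
theorem eq_conj_of_coind {A : Type*} [Monoid A] {f : A →* Bar N} {W : Type*} [AddCommGroup W]
    [Module ℂ W] {σ : Representation ℂ A W} {μ ν : CharGroup N}
    (hσ : ∀ n : N, ∃ a, f a = ((n : Ω) : Bar N) ∧ ∀ w, σ a w = ((μ n : ℂˣ) : ℂ) • w)
    {F : Representation.coindV f σ}
    (hF : ∀ n : N, Representation.coind f σ ((n : Ω) : Bar N) F = ((ν n : ℂˣ) : ℂ) • F)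
    {g : Ω} (hg : F.1 (g : Bar N) ≠ 0) : ν = μ.conj g := by
  ext n
  apply smul_left_injective ℂ hg
  change ((ν n : ℂˣ) : ℂ) • F.1 (g : Bar N) = ((μ.conj g n : ℂˣ) : ℂ) • F.1 (g : Bar N)
  rw [← coind_apply_mul hσ]
  exact (congrFun (congrArg Subtype.val (hF n)) (g : Bar N)).symm

theorem exists_conj_of_coind {A : Type*} [Monoid A] {f : A →* Bar N} {W : Type*}
    [AddCommGroup W] [Module ℂ W] {σ : Representation ℂ A W} {μ ν : CharGroup N}
    (hσ : ∀ n : N, ∃ a, f a = ((n : Ω) : Bar N) ∧ ∀ w, σ a w = ((μ n : ℂˣ) : ℂ) • w)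
    {F : Representation.coindV f σ}
    (hF : ∀ n : N, Representation.coind f σ ((n : Ω) : Bar N) F = ((ν n : ℂˣ) : ℂ) • F)
    (h0 : F ≠ 0) : ν ∈ μ.orbit := by
  by_contra hν
  apply h0
  apply Subtype.ext
  funext b
  induction b using QuotientGroup.induction_on with
  | H g =>
    by_contra hg
    exact hν ⟨g, (eq_conj_of_coind hσ hF hg).symm⟩

namespace ContRep

theorem barInclusion_mem_isotypic {V : ContRep (Bar N)} {μ : CharGroup N}
    (a : Bar μ.stabN) {v : V.V} (hv : v ∈ V.isotypic μ) :
    V.ρ (barInclusion N μ.stabilizer μ.le_stabilizer a) v ∈ V.isotypic μ := by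
  induction a using QuotientGroup.induction_on with
  | H k =>
    apply apply_mem_isotypic (k : Ω)
    rwa [show μ.conj k = μ from k.2]

/-- The `μ`-isotypic part of a representation of `Ω / [N, N]` as a representation of
`Ω_μ / [N, N]`. -/
noncomputable def isotypicRep (V : ContRep (Bar N)) (μ : CharGroup N) : ContRep (Bar μ.stabN) where
  V := V.isotypic μ
  ρ :=
    { toFun := fun a => (V.ρ (barInclusion N μ.stabilizer μ.le_stabilizer a)).restrict
        fun _ hv => barInclusion_mem_isotypic a hv
      map_one' := by
        apply LinearMap.ext
        intro v
        apply Subtype.ext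
        change V.ρ _ (v : V.V) = v
        rw [map_one, map_one, Module.End.one_apply]
      map_mul' := fun a b => by
        apply LinearMap.ext
        intro v
        apply Subtype.ext
        change V.ρ _ (v : V.V) = V.ρ _ (V.ρ _ (v : V.V))
        rw [map_mul, map_mul, Module.End.mul_apply] }
  continuous_coeff v l := by
    obtain ⟨l', hl'⟩ := LinearMap.exists_extend l
    refine ((V.continuous_coeff v l').comp
      (isOpenEmbedding_barInclusion μ.le_stabilizer).continuous).congr fun g => ?_
    rw [← hl']
    rfl

/-- The restriction of an intertwining map to the isotypic parts. -/
noncomputable def isotypicMap {V W : ContRep (Bar N)} (T : V.ρ.IntertwiningMap W.ρ) (μ : CharGroup N) :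
    (V.isotypicRep μ).ρ.IntertwiningMap (W.isotypicRep μ).ρ where
  toLinearMap := T.toLinearMap.restrict fun _ hv => map_mem_isotypic T hv
  isIntertwining' a := by
    apply LinearMap.ext
    intro v
    apply Subtype.ext
    exact T.isIntertwining _ _ _ (Subtype.val (p := (· ∈ V.isotypic μ)) v)

theorem isotypicRep_isotypic (V : ContRep (Bar N)) (μ : CharGroup N) :
    (V.isotypicRep μ).isotypic μ.stabChar = ⊤ := by
  rw [eq_top_iff]
  intro v _ n
  apply Subtype.ext
  exact v.2 ⟨((n : μ.stabilizer) : Ω), n.2⟩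

theorem charsOn_subset_of_isotypic_eq_top {V : ContRep (Bar N)} {μ : CharGroup N}
    (h : V.isotypic μ = ⊤) : V.charsOn N ⊆ {μ} := by
  rintro ν ⟨v, hv0, hv⟩
  rw [Set.mem_singleton_iff]
  ext n
  apply smul_left_injective ℂ hv0
  have h1 : v ∈ V.isotypic μ := h ▸ Submodule.mem_top
  exact (hv n).symm.trans (h1 n)

/-- For invariant `μ` the `μ`-part is a nonzero subrepresentation. -/
theorem isotypic_eq_top_of_irreducible {V : ContRep (Bar N)} {μ : CharGroup N}
    (hV : V.ρ.IsIrreducible) (h : V.charsOn N = {μ}) (hμ : μ.orbit = {μ}) :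
    V.isotypic μ = ⊤ := by
  let S : Subrepresentation V.ρ :=
    { toSubmodule := V.isotypic μ
      apply_mem_toSubmodule := fun b v hv => by
        induction b using QuotientGroup.induction_on with
        | H g =>
          apply apply_mem_isotypic g
          have h1 : μ.conj g ∈ μ.orbit := ⟨g, rfl⟩
          rw [hμ, Set.mem_singleton_iff] at h1
          rwa [h1] }
  rcases eq_bot_or_eq_top S with hS | hS
  · obtain ⟨v, hv, hv0⟩ := mem_charsOn_iff.1 (h.symm ▸ Set.mem_singleton μ : μ ∈ V.charsOn N)
    have h1 : V.isotypic μ = ⊥ := congrArg Subrepresentation.toSubmodule hS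
    rw [h1] at hv
    exact absurd hv hv0
  · exact congrArg Subrepresentation.toSubmodule hS

theorem stabN_acts {μ : CharGroup N} {W : ContRep (Bar μ.stabN)}
    (hW : W.isotypic μ.stabChar = ⊤) (n : N) :
    ∃ a, barInclusion N μ.stabilizer μ.le_stabilizer a = ((n : Ω) : Bar N) ∧
      ∀ w, W.ρ a w = ((μ n : ℂˣ) : ℂ) • w := by
  refine ⟨((⟨n, μ.le_stabilizer n n.2⟩ : μ.stabilizer) : Bar μ.stabN), rfl, fun w => ?_⟩
  have hw : w ∈ W.isotypic μ.stabChar := hW ▸ Submodule.mem_top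
  exact hw ⟨⟨n, μ.le_stabilizer n n.2⟩, n.2⟩

variable [CompactSpace Ω]

/-- Induction from `Ω_μ / [N, N]` to `Ω / [N, N]`. -/
noncomputable abbrev stabInd {μ : CharGroup N} (W : ContRep (Bar μ.stabN)) : ContRep (Bar N) :=
  W.ind (barInclusion N μ.stabilizer μ.le_stabilizer)
    (isOpenEmbedding_barInclusion μ.le_stabilizer).isOpenMap

theorem stabInd_charsOn {μ : CharGroup N} {W : ContRep (Bar μ.stabN)}
    (hW : W.isotypic μ.stabChar = ⊤) : W.stabInd.charsOn N ⊆ μ.orbit := by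
  rintro ν ⟨F, hF0, hF⟩
  exact exists_conj_of_coind (stabN_acts hW) hF hF0

/-- A `μ`-isotypic function is supported on `Ω_μ`, where equivariance determines it by its value at
`1`. -/
theorem stabInd_isotypic_ext {μ : CharGroup N} {W : ContRep (Bar μ.stabN)}
    (hW : W.isotypic μ.stabChar = ⊤)
    {F : Representation.coindV (barInclusion N μ.stabilizer μ.le_stabilizer) W.ρ}
    (hF : F ∈ W.stabInd.isotypic μ) (h1 : F.1 1 = 0) : F = 0 := by
  apply Subtype.ext
  funext b
  induction b using QuotientGroup.induction_on with
  | H g =>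
    by_contra hg
    have h2 : μ = μ.conj g := eq_conj_of_coind (stabN_acts hW) hF hg
    apply hg
    have h3 := F.2 ((⟨g, h2.symm⟩ : μ.stabilizer) : Bar μ.stabN) 1
    rw [h1, map_zero, mul_one] at h3
    exact h3

theorem stabInd_exists_isotypic {μ : CharGroup N} {W : ContRep (Bar μ.stabN)}
    (hW : W.isotypic μ.stabChar = ⊤) (w : W.V) :
    ∃ F : Representation.coindV (barInclusion N μ.stabilizer μ.le_stabilizer) W.ρ,
      F ∈ W.stabInd.isotypic μ ∧ F.1 1 = w := by
  set ι := barInclusion N μ.stabilizer μ.le_stabilizer with hι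
  have hinj : Function.Injective ι := (isOpenEmbedding_barInclusion μ.le_stabilizer).injective
  -- The only possible function: the orbit map of `w` on `Ω_μ / [N, N]`, extended by zero.
  let E : Bar N → W.V := Function.extend ι (fun a => W.ρ a w) 0
  have hE : ∀ a, E (ι a) = W.ρ a w := fun a => hinj.extend_apply _ _ a
  have hE' : ∀ b, b ∉ ι.range → E b = 0 := fun b hb =>
    Function.extend_apply' _ _ _ fun ⟨a, ha⟩ => hb ⟨a, ha⟩
  refine ⟨⟨E, fun a b => ?_⟩, fun n => ?_, ?_⟩
  · by_cases hb : b ∈ ι.range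
    · obtain ⟨a', rfl⟩ := hb
      rw [← map_mul, hE, hE, map_mul, Module.End.mul_apply]
    · rw [hE' b hb, map_zero, hE']
      rwa [Subgroup.mul_mem_cancel_left _ (⟨a, rfl⟩ : ι a ∈ ι.range)]
  · apply Subtype.ext
    funext b
    change E (b * ((n : Ω) : Bar N)) = ((μ n : ℂˣ) : ℂ) • E b
    obtain ⟨a, ha, haw⟩ := stabN_acts hW n
    rw [← hι] at ha
    rw [← ha]
    by_cases hb : b ∈ ι.range
    · obtain ⟨a', rfl⟩ := hb
      rw [← map_mul, hE, hE, map_mul, Module.End.mul_apply, haw, map_smul]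
    · rw [hE' b hb, smul_zero, hE']
      rwa [Subgroup.mul_mem_cancel_right _ (⟨a, rfl⟩ : ι a ∈ ι.range)]
  · change E 1 = w
    rw [← map_one ι, hE, map_one, Module.End.one_apply]

/-- `(Ind W)_μ ≅ W` if `N` acts on `W` by `μ`. -/
theorem of_isotypicRep_stabInd {μ : CharGroup N} {W : ContRep (Bar μ.stabN)}
    (hW : W.isotypic μ.stabChar = ⊤) :
    RepGroup.of (W.stabInd.isotypicRep μ) = RepGroup.of W := by
  let T : (W.stabInd.isotypicRep μ).ρ.IntertwiningMap W.ρ :=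
    { toFun := fun F => F.1.1 1
      map_add' := fun _ _ => rfl
      map_smul' := fun _ _ => rfl
      isIntertwining' := fun a => by
        apply LinearMap.ext
        intro F
        change F.1.1 (1 * barInclusion N μ.stabilizer μ.le_stabilizer a) = W.ρ a (F.1.1 1)
        rw [← F.1.2, one_mul, mul_one] }
  refine RepGroup.of_eq_of_equiv T ⟨(injective_iff_map_eq_zero T).2 fun F hF => ?_, fun w => ?_⟩
  · exact Subtype.ext (stabInd_isotypic_ext hW F.2 hF)
  · obtain ⟨F, hF, h1⟩ := stabInd_exists_isotypic hW w
    exact ⟨⟨F, hF⟩, h1⟩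

/-- `Ind (V_μ) ≅ V` if all characters of `N` on `V` are conjugate to `μ`. -/
theorem of_stabInd_isotypicRep {μ : CharGroup N} {V : ContRep (Bar N)}
    (hV : V.charsOn N ⊆ μ.orbit) : RepGroup.of (V.isotypicRep μ).stabInd = RepGroup.of V := by
  obtain ⟨P, hP, hP1, hP2⟩ := V.exists_isotypic_projection μ
  have hid : ∀ v ∈ V.isotypic μ, P v = v := fun v hv => hP2 LinearMap.id v v hv
  have hcomm : ∀ (a : Bar μ.stabN) (v : V.V),
      P (V.ρ (barInclusion N μ.stabilizer μ.le_stabilizer a) v) =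
        V.ρ (barInclusion N μ.stabilizer μ.le_stabilizer a) (P v) := by
    intro a v
    -- Insert `P` in front of the right-hand side and compute it by `hP2`; conjugation by `k` fixes
    -- `μ`, so `P ∘ ρ k` transforms under `N` by `μ` again.
    rw [← hid _ (barInclusion_mem_isotypic a (hP v))]
    symm
    refine hP2 (P ∘ₗ V.ρ (barInclusion N μ.stabilizer μ.le_stabilizer a)) v _ fun n => ?_
    induction a using QuotientGroup.induction_on with
    | H k =>
      have h1 := hP1 ⟨k * n * (k : Ω)⁻¹, N.isNormal'.conj_mem n n.2 k⟩ (V.ρ ((k : Ω) : Bar N) v)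
      rw [bar_conj] at h1
      have h2 : μ ⟨k * n * (k : Ω)⁻¹, N.isNormal'.conj_mem n n.2 k⟩ = μ n :=
        congrArg (fun ν : CharGroup N => ν n) (show μ.conj k = μ from k.2)
      rw [h2] at h1
      have h3 : (k : Ω)⁻¹ * (k * n * (k : Ω)⁻¹) * k = n := by group
      rw [h3] at h1
      exact h1
  have htop := V.isotypicRep_isotypic μ
  let T : V.ρ.IntertwiningMap (V.isotypicRep μ).stabInd.ρ :=
    { toFun := fun v => ⟨fun b => ⟨P (V.ρ b v), hP _⟩, fun a b => Subtype.ext (by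
        change P (V.ρ (barInclusion N μ.stabilizer μ.le_stabilizer a * b) v) =
          V.ρ (barInclusion N μ.stabilizer μ.le_stabilizer a) (P (V.ρ b v))
        rw [map_mul, Module.End.mul_apply]
        exact hcomm a _)⟩
      map_add' := fun v w => Subtype.ext <| funext fun b => Subtype.ext <|
        (congrArg P (map_add (V.ρ b) v w)).trans (map_add P _ _)
      map_smul' := fun c v => Subtype.ext <| funext fun b => Subtype.ext <|
        (congrArg P (map_smul (V.ρ b) c v)).trans (map_smul P _ _)
      isIntertwining' := fun g => by
        apply LinearMap.ext
        intro v
        apply Subtype.ext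
        funext b
        apply Subtype.ext
        change P (V.ρ b (V.ρ g v)) = P (V.ρ (b * g) v)
        rw [map_mul, Module.End.mul_apply] }
  have hT1 : ∀ v ∈ V.isotypic μ, Subtype.val (p := (· ∈ V.isotypic μ)) ((T v).1 1) = v := fun v hv => by
    change P (V.ρ 1 v) = v
    rw [map_one, Module.End.one_apply, hid v hv]
  refine (RepGroup.of_eq_of_equiv T (bijective_of_isotypic T hV (stabInd_charsOn htop)
    (fun v hv h0 => ?_) fun F hF => ?_)).symm
  · rw [← hT1 v hv, h0]
    rfl
  -- A `μ`-isotypic `F` is the image of its value at `1`: the difference is `μ`-isotypic and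
  -- vanishes at `1`.
  · have h1 := (F.1 1).2
    refine ⟨(F.1 1).1, ?_⟩
    rw [← sub_eq_zero]
    refine stabInd_isotypic_ext htop (sub_mem (map_mem_isotypic T h1) hF) ?_
    apply Subtype.ext
    change ((T (F.1 1).1).1 1).1 - (F.1 1).1 = 0
    rw [hT1 _ h1, sub_self]

end ContRep

variable [CompactSpace Ω]

theorem ContRep.IsShortExact.isotypicRep {U V W : ContRep (Bar N)}
    (h : ContRep.IsShortExact U V W) (μ : CharGroup N) :
    ContRep.IsShortExact (U.isotypicRep μ) (V.isotypicRep μ) (W.isotypicRep μ) := by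
  obtain ⟨i, p, hi, he, hp⟩ := h
  refine ⟨ContRep.isotypicMap i μ, ContRep.isotypicMap p μ, fun x y hxy => ?_, fun v => ?_,
    fun w => ?_⟩
  · exact Subtype.ext (hi (congrArg Subtype.val hxy))
  · constructor
    · intro hv
      obtain ⟨x, hx⟩ := (he v.1).1 (congrArg Subtype.val hv)
      exact ⟨⟨x, ContRep.mem_isotypic_of_map_mem i hi (hx ▸ v.2)⟩, Subtype.ext hx⟩
    · rintro ⟨x, rfl⟩
      exact Subtype.ext ((he _).2 ⟨x.1, rfl⟩)
  · obtain ⟨v, hv, hvw⟩ := ContRep.exists_isotypic_lift p hp w.2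
    exact ⟨⟨v, hv⟩, Subtype.ext hvw⟩

/-- The homomorphism `R(Ω / [N, N]) → R(Ω_μ / [N, N])`, `[V] ↦ [V_μ]`. -/
noncomputable def RepGroup.isotypic (μ : CharGroup N) : RepGroup (Bar N) →+ RepGroup (Bar μ.stabN) :=
  QuotientAddGroup.lift _
    (FreeAbelianGroup.lift fun V : ContRep (Bar N) => RepGroup.of (V.isotypicRep μ)) (by
      rw [ContRep.relations, AddSubgroup.closure_le]
      rintro x ⟨U, V, W, h, rfl⟩
      change FreeAbelianGroup.lift _ _ = 0
      rw [map_sub, map_sub, FreeAbelianGroup.lift_apply_of, FreeAbelianGroup.lift_apply_of,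
        FreeAbelianGroup.lift_apply_of, RepGroup.of_eq_add (h.isotypicRep μ)]
      abel)

theorem RepGroup.isotypic_of (μ : CharGroup N) (V : ContRep (Bar N)) :
    RepGroup.isotypic μ (RepGroup.of V) = RepGroup.of (V.isotypicRep μ) :=
  FreeAbelianGroup.lift_apply_of _ _

theorem CharGroup.indRep_of (μ : CharGroup N) (W : ContRep (Bar μ.stabN)) :
    μ.indRep (RepGroup.of W) = RepGroup.of W.stabInd :=
  FreeAbelianGroup.lift_apply_of _ _

/-- `V ↦ V_μ` is a two-sided inverse; as both maps are additive, everything is checked on generating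
irreducibles. -/
theorem CharGroup.bijOn_indRep (μ : CharGroup N) :
    Set.BijOn μ.indRep (RepGroup.part μ.stabN {μ.stabChar}) (RepGroup.part N μ.orbit) := by
  have htop : ∀ W : ContRep (Bar μ.stabN), W.ρ.IsIrreducible → W.charsOn _ = {μ.stabChar} →
      W.isotypic μ.stabChar = ⊤ := fun W hW h =>
    ContRep.isotypic_eq_top_of_irreducible hW h μ.orbit_stabChar
  refine Set.InvOn.bijOn (f' := RepGroup.isotypic μ) ⟨?_, ?_⟩ ?_ ?_
  · refine AddMonoidHom.eqOn_closure (f := (RepGroup.isotypic μ).comp μ.indRep)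
      (g := AddMonoidHom.id _) ?_
    rintro _ ⟨W, hW, h, rfl⟩
    change RepGroup.isotypic μ (μ.indRep (RepGroup.of W)) = RepGroup.of W
    rw [μ.indRep_of, RepGroup.isotypic_of, ContRep.of_isotypicRep_stabInd (htop W hW h)]
  · refine AddMonoidHom.eqOn_closure (f := μ.indRep.comp (RepGroup.isotypic μ))
      (g := AddMonoidHom.id _) ?_
    rintro _ ⟨V, -, h, rfl⟩
    change μ.indRep (RepGroup.isotypic μ (RepGroup.of V)) = RepGroup.of V
    rw [RepGroup.isotypic_of, μ.indRep_of, ContRep.of_stabInd_isotypicRep h.subset]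
  · refine (AddSubgroup.closure_le ((RepGroup.part N μ.orbit).comap μ.indRep)).2 ?_
    rintro _ ⟨W, hW, h, rfl⟩
    change μ.indRep _ ∈ RepGroup.part N μ.orbit
    rw [μ.indRep_of]
    exact ContRep.of_mem_part _ (ContRep.stabInd_charsOn (htop W hW h))
  · refine (AddSubgroup.closure_le
      ((RepGroup.part μ.stabN {μ.stabChar}).comap (RepGroup.isotypic μ))).2 ?_
    rintro _ ⟨V, -, h, rfl⟩
    change RepGroup.isotypic μ _ ∈ RepGroup.part μ.stabN {μ.stabChar}
    rw [RepGroup.isotypic_of, ← μ.orbit_stabChar]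
    apply ContRep.of_mem_part
    rw [μ.orbit_stabChar]
    exact ContRep.charsOn_subset_of_isotypic_eq_top (V.isotypicRep_isotypic μ)

end Stabilizer

/-! ### Bijections of generators. -/

theorem FreeAbelianGroup.bijOn_map_closure {α β : Type*} {f : α → β} {s : Set α} {t : Set β}
    (h : Set.BijOn f s t) :
    Set.BijOn (FreeAbelianGroup.map f) (AddSubgroup.closure (FreeAbelianGroup.of '' s))
      (AddSubgroup.closure (FreeAbelianGroup.of '' t)) := by
  classical
  have himage : (AddSubgroup.closure (FreeAbelianGroup.of '' s)).map (FreeAbelianGroup.map f) =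
      AddSubgroup.closure (FreeAbelianGroup.of '' t) := by
    rw [AddMonoidHom.map_closure, ← h.image_eq, Set.image_image, Set.image_image]
    simp only [FreeAbelianGroup.map_of_apply]
  refine ⟨?_, ?_, ?_⟩
  · rw [← himage]
    exact Set.mapsTo_image _ _
  · rcases s.eq_empty_or_nonempty with rfl | ⟨a, -⟩
    · simp
    have : Nonempty α := ⟨a⟩
    refine Set.LeftInvOn.injOn (f₁' := FreeAbelianGroup.map (Function.invFunOn f s)) ?_
    refine AddMonoidHom.eqOn_closure
      (f := (FreeAbelianGroup.map (Function.invFunOn f s)).comp (FreeAbelianGroup.map f))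
      (g := AddMonoidHom.id _) ?_
    rintro _ ⟨x, hx, rfl⟩
    change FreeAbelianGroup.map _ (FreeAbelianGroup.map _ (FreeAbelianGroup.of x)) = _
    rw [FreeAbelianGroup.map_of_apply, FreeAbelianGroup.map_of_apply,
      h.injOn.leftInvOn_invFunOn hx]
    rfl
  · rw [← himage]
    exact Set.surjOn_image _ _

/-! ### Monomial pairs and invariant characters. -/

section Diagram

variable {Ω : Type u} [Group Ω] [TopologicalSpace Ω] [IsTopologicalGroup Ω]
  {N : OpenNormalSubgroup Ω}

theorem CharGroup.orbit_eq_of_mem {μ ν : CharGroup N} (h : ν ∈ μ.orbit) : ν.orbit = μ.orbit := by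
  obtain ⟨g, rfl⟩ := h
  ext κ
  constructor
  · rintro ⟨g', rfl⟩
    exact ⟨g * g', μ.conj_mul g g'⟩
  · rintro ⟨g', rfl⟩
    refine ⟨g⁻¹ * g', ?_⟩
    change (μ.conj g).conj _ = μ.conj g'
    rw [← CharGroup.conj_mul, mul_inv_cancel_left]

omit [IsTopologicalGroup Ω] in
theorem RPlus.part_eq (ξ : Set (CharGroup N)) :
    RPlus.part N ξ = AddSubgroup.closure
      (FreeAbelianGroup.of '' (Quotient.mk (MonomialPair.setoid N) '' {p | p.resN ∈ ξ})) := by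
  rw [RPlus.part, Set.image_image]
  congr 1
  ext x
  exact ⟨fun ⟨p, hp, hx⟩ => ⟨p, hp, hx.symm⟩, fun ⟨p, hp, hx⟩ => ⟨p, hp, hx.symm⟩⟩

/-- The conjugate `(g⁻¹ H g, χ^g)` of a pair. -/
noncomputable def MonomialPair.conj (p : MonomialPair N) (g : Ω) : MonomialPair N where
  H := p.H.comap (MulAut.conj g).toMonoidHom (by
    change Continuous fun x => g * x * g⁻¹
    fun_prop)
  le x hx := p.le _ (N.isNormal'.conj_mem x hx g)
  χ :=
    { toFun := fun x => p.χ ⟨g * x * g⁻¹, x.2⟩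
      map_one' := by
        rw [← map_one p.χ]
        congr 1
        apply Subtype.ext
        simp
      map_mul' := fun x y => by
        rw [← map_mul p.χ]
        congr 1
        apply Subtype.ext
        change g * ((x : Ω) * y) * g⁻¹ = g * x * g⁻¹ * (g * y * g⁻¹)
        group
      continuous_toFun := by
        refine p.χ.continuous_toFun.comp (Continuous.subtype_mk ?_ _)
        fun_prop }

theorem MonomialPair.mk_conj (p : MonomialPair N) (g : Ω) :
    Quotient.mk (MonomialPair.setoid N) (p.conj g) = Quotient.mk _ p :=
  (Quotient.sound ⟨g, fun _ => Iff.rfl, fun _ _ => rfl⟩ :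
    Quotient.mk (MonomialPair.setoid N) p = Quotient.mk _ (p.conj g)).symm

theorem MonomialPair.resN_conj (p : MonomialPair N) (g : Ω) :
    (p.conj g).resN = p.resN.conj g := rfl

/-- The extension `χ` of `χ|_N` has commutative target, so conjugation by `H` does not change it.
Hence `H ≤ Ω_μ` when `χ|_N = μ`. -/
theorem MonomialPair.mem_stabilizer_resN (p : MonomialPair N) {h : Ω} (hh : h ∈ p.H) :
    h ∈ p.resN.stabilizer := by
  change p.resN.conj h = p.resN
  ext n
  have h1 : p.χ ((⟨h, hh⟩ : p.H) * ⟨n, p.le n n.2⟩ * (⟨h, hh⟩ : p.H)⁻¹) =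
      p.χ ⟨n, p.le n n.2⟩ := by
    rw [map_mul, map_mul, map_inv, mul_comm (p.χ ⟨h, hh⟩), mul_inv_cancel_right]
  exact congrArg Units.val h1

/-- A pair `(H, χ)` with `H ≤ K` as a pair for `K`. -/
noncomputable def MonomialPair.within (p : MonomialPair N) (K : OpenSubgroup Ω) :
    MonomialPair (N.within K) where
  H := p.H.comap (SubgroupClass.subtype K) continuous_subtype_val
  le x hx := p.le x hx
  χ :=
    { toFun := fun x => p.χ ⟨x, x.2⟩
      map_one' := map_one p.χ
      map_mul' := fun x y => map_mul p.χ ⟨x, x.2⟩ ⟨y, y.2⟩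
      continuous_toFun := p.χ.continuous_toFun.comp
        (Continuous.subtype_mk (continuous_subtype_val.comp continuous_subtype_val) _) }

theorem MonomialPair.mk_extend_within (p : MonomialPair N) {K : OpenSubgroup Ω}
    (hK : ∀ x ∈ N, x ∈ K) (hp : ∀ x ∈ p.H, x ∈ K) :
    Quotient.mk (MonomialPair.setoid N) ((p.within K).extend hK) = Quotient.mk _ p := by
  apply Quotient.sound
  refine ⟨1, fun x => ?_, fun x hx => ?_⟩
  · rw [one_mul, inv_one, mul_one]
    exact ⟨fun hx => ⟨⟨x, hp x hx⟩, hx, rfl⟩, by rintro ⟨y, hy, rfl⟩; exact hy⟩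
  · change p.χ _ = p.χ _
    congr 1
    apply Subtype.ext
    simp

theorem MonomialPair.resN_extend_eq {μ : CharGroup N} {p : MonomialPair μ.stabN}
    (hp : p.resN = μ.stabChar) : (p.extend μ.le_stabilizer).resN = μ := by
  ext n
  exact congrArg (fun ν : CharGroup μ.stabN =>
    ((ν ⟨⟨n, μ.le_stabilizer n n.2⟩, n.2⟩ : ℂˣ) : ℂ)) hp

theorem CharGroup.bijOn_indPlus (μ : CharGroup N) :
    Set.BijOn μ.indPlus (RPlus.part μ.stabN {μ.stabChar}) (RPlus.part N μ.orbit) := by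
  rw [RPlus.part_eq, RPlus.part_eq]
  refine FreeAbelianGroup.bijOn_map_closure ⟨?_, ?_, ?_⟩
  · rintro _ ⟨p, hp, rfl⟩
    refine ⟨p.extend μ.le_stabilizer, ?_, rfl⟩
    change _ ∈ μ.orbit
    rw [MonomialPair.resN_extend_eq hp]
    exact μ.self_mem_orbit
  · rintro _ ⟨p, hp, rfl⟩ _ ⟨q, hq, rfl⟩ hpq
    obtain ⟨g, h, hχ⟩ : (p.extend μ.le_stabilizer).IsConjugate (q.extend μ.le_stabilizer) :=
      Quotient.exact hpq
    -- Both pairs restrict to `μ`, so the conjugating element lies in `Ω_μ`.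
    have hg : μ.conj g = μ := by
      rw [← MonomialPair.resN_extend_eq hp]
      conv_rhs => rw [MonomialPair.resN_extend_eq hp, ← MonomialPair.resN_extend_eq hq]
      ext n
      exact congrArg Units.val (hχ n ((q.extend μ.le_stabilizer).le n n.2)).symm
    apply Quotient.sound
    refine ⟨⟨g, hg⟩, fun x => ⟨fun hx => ?_, fun hx => ?_⟩, fun x hx => ?_⟩
    · exact mem_of_mem_map' ((h x).1 ⟨x, hx, rfl⟩)
    · exact mem_of_mem_map' ((h x).2 ⟨_, hx, rfl⟩)
    · exact hχ x ⟨x, hx, rfl⟩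
  · rintro _ ⟨p, ⟨g, hg⟩, rfl⟩
    -- Conjugating by `g⁻¹` undoes `χ|_N = μ^g`; the new pair then lives inside `Ω_μ`.
    have hres : (p.conj g⁻¹).resN = μ := by
      change μ.conj g = p.resN at hg
      rw [MonomialPair.resN_conj, ← hg, ← CharGroup.conj_mul, mul_inv_cancel,
        μ.conj_of_mem N.one_mem']
    have hle : ∀ x ∈ (p.conj g⁻¹).H, x ∈ μ.stabilizer := fun x hx => by
      have h := (p.conj g⁻¹).mem_stabilizer_resN hx
      rwa [hres] at h
    refine ⟨Quotient.mk _ ((p.conj g⁻¹).within μ.stabilizer), ⟨_, ?_, rfl⟩, ?_⟩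
    · change _ = μ.stabChar
      ext n
      exact congrArg (fun ν : CharGroup N => ((ν ⟨((n : μ.stabilizer) : Ω), n.2⟩ : ℂˣ) : ℂ)) hres
    · exact ((p.conj g⁻¹).mk_extend_within μ.le_stabilizer hle).trans (p.mk_conj g⁻¹)

/-- Invariance under `g` says that `ν` kills the commutators of `N` with `g`; closure costs nothing
because `ker ν` is closed. It is applied with `Ω_μ` as the ambient group. -/
theorem CharGroup.orbit_eq_singleton_iff (ν : CharGroup N) : ν.orbit = {ν} ↔
    ∀ n : N, (n : Ω) ∈ (⁅N.toSubgroup, (⊤ : Subgroup Ω)⁆).topologicalClosure → ν n = 1 := by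
  constructor
  · intro h
    -- The kernel viewed in `Ω`, where it stays closed since the open subgroup `N` is closed.
    let S : Subgroup Ω := (ν : N →* ℂˣ).ker.map N.toSubgroup.subtype
    have hS : IsClosed (S : Set Ω) := by
      have h1 : IsClosed ((ν : N →* ℂˣ).ker : Set N) :=
        isClosed_singleton.preimage ν.continuous_toFun
      exact N.toOpenSubgroup.isClosed.isClosedMap_subtype_val _ h1
    have hle : ⁅N.toSubgroup, (⊤ : Subgroup Ω)⁆ ≤ S := by
      rw [Subgroup.commutator_le]
      intro n hn g _
      have hm := N.isNormal'.conj_mem _ (N.toSubgroup.inv_mem hn) g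
      refine ⟨⟨n, hn⟩ * ⟨g * n⁻¹ * g⁻¹, hm⟩, ?_, ?_⟩
      · have h1 : ν.conj g = ν := by
          have : ν.conj g ∈ ν.orbit := ⟨g, rfl⟩
          rwa [h] at this
        have h2 : ν ⟨g * n⁻¹ * g⁻¹, hm⟩ = ν (⟨n, hn⟩⁻¹) :=
          congrArg (fun κ : CharGroup N => κ (⟨n, hn⟩⁻¹)) h1
        change ν (⟨n, hn⟩ * ⟨g * n⁻¹ * g⁻¹, hm⟩) = 1
        rw [map_mul, h2, map_inv, mul_inv_cancel]
      · change n * (g * n⁻¹ * g⁻¹) = _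
        simp [commutatorElement_def, mul_assoc]
    intro n hn
    obtain ⟨m, hm, hmn⟩ := Subgroup.topologicalClosure_minimal _ hle hS hn
    obtain rfl : m = n := Subtype.ext hmn
    exact hm
  · intro h
    refine Set.Subset.antisymm ?_ (Set.singleton_subset_iff.2 ν.self_mem_orbit)
    rintro _ ⟨g, rfl⟩
    rw [Set.mem_singleton_iff]
    ext n
    congr 1
    have hm := N.isNormal'.conj_mem n n.2 g
    have h1 := h (n⁻¹ * ⟨g * n * g⁻¹, hm⟩) (Subgroup.le_topologicalClosure _ (by
      have h2 := Subgroup.commutator_mem_commutator (N.toSubgroup.inv_mem n.2)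
        (Subgroup.mem_top g)
      simpa [commutatorElement_def, mul_assoc] using h2))
    rw [map_mul, map_inv, inv_mul_eq_one] at h1
    exact h1.symm

/-! ### The Brauer map and the commutative square. -/

variable [CompactSpace Ω]

theorem brauerMap_of (p : MonomialPair N) :
    brauerMap N (RPlus.of p) = RepGroup.of p.indRep :=
  FreeAbelianGroup.lift_apply_of _ _

theorem MonomialPair.indRep_charsOn (p : MonomialPair N) :
    p.indRep.charsOn N ⊆ p.resN.orbit := by
  rintro ν ⟨F, hF0, hF⟩
  exact exists_conj_of_coind (fun n => ⟨⟨n, p.le n n.2⟩, rfl, fun _ => rfl⟩) hF hF0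

theorem CharGroup.mapsTo_brauerMap (μ : CharGroup N) :
    Set.MapsTo (brauerMap N) (RPlus.part N μ.orbit) (RepGroup.part N μ.orbit) := by
  refine (AddSubgroup.closure_le ((RepGroup.part N μ.orbit).comap (brauerMap N))).2 ?_
  rintro _ ⟨p, hp, rfl⟩
  change brauerMap N (RPlus.of p) ∈ RepGroup.part N μ.orbit
  rw [brauerMap_of]
  apply ContRep.of_mem_part
  rw [← CharGroup.orbit_eq_of_mem hp]
  exact p.indRep_charsOn

/-- Transitivity of induction. -/
theorem MonomialPair.of_indRep_extend {K : OpenSubgroup Ω} (hK : ∀ x ∈ N, x ∈ K)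
    (p : MonomialPair (N.within K)) :
    RepGroup.of (p.extend hK).indRep = RepGroup.of
      (p.indRep.ind (barInclusion N K hK) (isOpenEmbedding_barInclusion hK).isOpenMap) := by
  set ι := barInclusion N K hK with hι
  let T : (p.extend hK).indRep.ρ.IntertwiningMap
      (p.indRep.ind ι (isOpenEmbedding_barInclusion hK).isOpenMap).ρ :=
    { toFun := fun F => ⟨fun b => ⟨fun a => F.1 (ι a * b), fun h a =>
          (congrArg F.1 (by rw [map_mul, mul_assoc]; rfl)).trans
            (F.2 ⟨((h : K) : Ω), ⟨h, h.2, rfl⟩⟩ (ι a * b))⟩, fun a b => by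
          apply Subtype.ext
          funext a'
          change F.1 (ι a' * (ι a * b)) = F.1 (ι (a' * a) * b)
          rw [map_mul, mul_assoc]⟩
      map_add' := fun _ _ => rfl
      map_smul' := fun _ _ => rfl
      isIntertwining' := fun g => by
        apply LinearMap.ext
        intro F
        apply Subtype.ext
        funext b
        apply Subtype.ext
        funext a
        exact congrArg F.1 (mul_assoc _ _ _) }
  refine RepGroup.of_eq_of_equiv T ⟨fun F F' h => ?_, fun G => ?_⟩
  · apply Subtype.ext
    funext b
    have h1 : F.1 (ι 1 * b) = F'.1 (ι 1 * b) :=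
      congrFun (congrArg Subtype.val (congrFun (congrArg Subtype.val h) b)) 1
    rwa [map_one, one_mul] at h1
  · have hG : ∀ (a a' : Bar (N.within K)) (b : Bar N),
        (G.1 (ι a * b)).1 a' = (G.1 b).1 (a' * a) := fun a a' b =>
      congrFun (congrArg Subtype.val (G.2 a b)) a'
    -- The inverse evaluates the inner function at `1`; by `hG` the other inner values are recovered
    -- by translating `b`.
    refine ⟨⟨fun b => (G.1 b).1 1, fun h b => ?_⟩, ?_⟩
    · have h1 := hG ((⟨h, mem_of_mem_map h.2⟩ : K) : Bar (N.within K)) 1 b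
      refine h1.trans ?_
      rw [one_mul]
      have h2 := (G.1 b).2 ⟨_, mem_of_mem_map' h.2⟩ 1
      rw [mul_one] at h2
      exact h2
    · apply Subtype.ext
      funext b
      apply Subtype.ext
      funext a
      change (G.1 (ι a * b)).1 1 = (G.1 b).1 a
      rw [hG, one_mul]

theorem brauerMap_ind {K : OpenSubgroup Ω} (hK : ∀ x ∈ N, x ∈ K) (x : RPlus (N.within K)) :
    brauerMap N (RPlus.ind N K hK x) = barInd N K hK (brauerMap (N.within K) x) := by
  refine DFunLike.congr_fun (FreeAbelianGroup.lift_ext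
    ((brauerMap N).comp (RPlus.ind N K hK))
    ((barInd N K hK).comp (brauerMap (N.within K))) fun c => ?_) x
  induction c using Quotient.inductionOn with
  | h p =>
    change brauerMap N (RPlus.ind N K hK (RPlus.of p)) =
      barInd N K hK (brauerMap (N.within K) (RPlus.of p))
    have h1 : RPlus.ind N K hK (RPlus.of p) = RPlus.of (p.extend hK) :=
      FreeAbelianGroup.map_of_apply _
    have h2 : barInd N K hK (RepGroup.of p.indRep) = RepGroup.of
        (p.indRep.ind (barInclusion N K hK) (isOpenEmbedding_barInclusion hK).isOpenMap) :=
      FreeAbelianGroup.lift_apply_of _ _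
    rw [h1, brauerMap_of, brauerMap_of, h2, MonomialPair.of_indRep_extend]

theorem CharGroup.mapsTo_brauerMap_stab (μ : CharGroup N) :
    Set.MapsTo (brauerMap μ.stabN) (RPlus.part μ.stabN {μ.stabChar})
      (RepGroup.part μ.stabN {μ.stabChar}) := by
  rw [← μ.orbit_stabChar]
  exact μ.stabChar.mapsTo_brauerMap

/-- Injectivity of induction on the part of `R(Ω_μ / [N, N])` at `μ` makes the two kernel conditions
equivalent under the bijection of the monomial parts. -/
theorem CharGroup.bijOn_brauerKer (μ : CharGroup N) :
    Set.BijOn μ.indPlus (brauerKer μ.stabN {μ.stabChar}) (brauerKer N μ.orbit) := by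
  have key : ∀ x ∈ RPlus.part μ.stabN {μ.stabChar},
      brauerMap N (μ.indPlus x) = 0 ↔ brauerMap μ.stabN x = 0 := by
    intro x hx
    rw [brauerMap_ind]
    constructor
    · intro h
      exact μ.bijOn_indRep.injOn (μ.mapsTo_brauerMap_stab hx) (zero_mem _)
        (h.trans (map_zero μ.indRep).symm)
    · intro h
      rw [h, map_zero]
  refine ⟨fun x hx => ⟨μ.bijOn_indPlus.mapsTo hx.1, (key x hx.1).2 hx.2⟩,
    μ.bijOn_indPlus.injOn.mono fun x hx => hx.1, fun y hy => ?_⟩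
  obtain ⟨x, hx, rfl⟩ := μ.bijOn_indPlus.surjOn hy.1
  exact ⟨x, ⟨hx, (key x hx).1 hy.2⟩, rfl⟩

end Diagram

theorem mainTheorem9 {Ω : Type u} [Group Ω] [TopologicalSpace Ω] [IsTopologicalGroup Ω]
    [CompactSpace Ω] [TotallyDisconnectedSpace Ω] (N : OpenNormalSubgroup Ω) (μ : CharGroup N) :
    -- the horizontal maps `φ_μ` and `φ_ξ` of the diagram, where `ξ` is the orbit of `μ`
    Set.MapsTo (brauerMap μ.stabN)
      (RPlus.part μ.stabN {μ.stabChar}) (RepGroup.part μ.stabN {μ.stabChar}) ∧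
    Set.MapsTo (brauerMap N) (RPlus.part N μ.orbit) (RepGroup.part N μ.orbit) ∧
    -- commutativity of the diagram
    (∀ x ∈ RPlus.part μ.stabN {μ.stabChar},
      brauerMap N (μ.indPlus x) = μ.indRep (brauerMap μ.stabN x)) ∧
    -- the vertical maps are bijections
    Set.BijOn μ.indPlus (brauerKer μ.stabN {μ.stabChar}) (brauerKer N μ.orbit) ∧
    Set.BijOn μ.indPlus (RPlus.part μ.stabN {μ.stabChar}) (RPlus.part N μ.orbit) ∧
    Set.BijOn μ.indRep (RepGroup.part μ.stabN {μ.stabChar}) (RepGroup.part N μ.orbit) ∧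
    brauerKer N μ.orbit = (brauerKer μ.stabN {μ.stabChar}).map μ.indPlus ∧
    -- for the group `Ω_μ` the orbit of `μ` is `{μ}`, and the invariant characters of `N` are
    -- the characters that are trivial on `[N, Ω_μ]`
    μ.stabChar.orbit = {μ.stabChar} ∧
    (∀ ν : CharGroup μ.stabN, ν.orbit = {ν} ↔
      ∀ n : μ.stabN, (n : μ.stabilizer) ∈
        (⁅μ.stabN.toSubgroup, (⊤ : Subgroup μ.stabilizer)⁆).topologicalClosure → ν n = 1) :=
  ⟨μ.mapsTo_brauerMap_stab, μ.mapsTo_brauerMap, fun x _ => brauerMap_ind μ.le_stabilizer x,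
    μ.bijOn_brauerKer, μ.bijOn_indPlus, μ.bijOn_indRep,
    SetLike.coe_injective μ.bijOn_brauerKer.image_eq.symm, μ.orbit_stabChar,
    fun ν => ν.orbit_eq_singleton_iff⟩
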